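/- Let $N\ge 3$ be an integer, $\alpha\in(0,N)$ and $p,q>0$ with $$p+q\ \ge\ \frac{2(N+\alpha)}{N-2}\qquad\text{or}\qquad p+q\ \le\ \frac{2(N+\alpha)}{N}.$$ Let $$I_\alpha(x)=\frac{\Gamma\left(\frac{N-\alpha}{2}\right)}{\pi^{N/2}\,2^{\alpha}\,\Gamma\left(\frac{\alpha}{2}\right)}\,|x|^{\alpha-N}$$ be the Riesz potential on $\mathbb{R}^N$, and let $u\in H^1(\mathbb{R}^N)$, with $u\ge 0$ almost everywhere, be a weak solution of $$-\Delta u+u=q\,(I_\alpha*|u|^p)\,|u|^{q-2}u+p\,(I_\alpha*|u|^q)\,|u|^{p-2}u\quad\text{in }\mathbb{R}^N;$$ that is, the convolutions $I_\alpha*|u|^p$ and $I_\alpha*|u|^q$ are finite almost everywhere, the right-hand side is in $L^1_{\mathrm{loc}}(\mathbb{R}^N)$ (where $|u|^{q-2}u$ and $|u|^{p-2}u$ are read as $0$ at points with $u=0$), and the equation holds when tested with every $\varphi\in C_c^\infty(\mathbb{R}^N)$. Assume moreover that $u\in L^{\frac{N(p+q)}{N+\alpha}}(\mathbb{R}^N)$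 and that $\nabla u\in H^1_{\mathrm{loc}}(\mathbb{R}^N;\mathbb{R}^N)$. Then $u=0$ almost everywhere in $\mathbb{R}^N$. -/

import Mathlib

open MeasureTheory
open scoped ContDiff

/-- The Euclidean space `ℝ^N`. -/
abbrev RN (N : ℕ) : Type := EuclideanSpace ℝ (Fin N)

/-- `v` is the weak partial derivative of `u` in the direction of the `i`-th coordinate. -/
def IsWeakPartial {N : ℕ} (i : Fin N) (u v : RN N → ℝ) : Prop :=
  LocallyIntegrable u volume ∧ LocallyIntegrable v volume ∧
    ∀ φ : RN N → ℝ, ContDiff ℝ ∞ φ → HasCompactSupport φ →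
      ∫ x, u x * fderiv ℝ φ x (EuclideanSpace.single i 1) = -∫ x, v x * φ x

/-- `G` is the weak gradient of `u` (unique up to null sets). -/
def IsWeakGradient {N : ℕ} (u : RN N → ℝ) (G : RN N → RN N) : Prop :=
  ∀ i : Fin N, IsWeakPartial i u (fun x => G x i)

/-- `u ∈ H¹(ℝ^N)`. -/
def MemH1 {N : ℕ} (u : RN N → ℝ) : Prop :=
  MemLp u 2 volume ∧ ∃ G : RN N → RN N, IsWeakGradient u G ∧ MemLp G 2 volume

/-- `u ∈ H¹_loc(ℝ^N)`: `u` and its weak gradient are square integrable on compact sets. -/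
def MemH1Loc {N : ℕ} (u : RN N → ℝ) : Prop :=
  (∀ K : Set (RN N), IsCompact K → MemLp u 2 (volume.restrict K)) ∧
    ∃ G : RN N → RN N, IsWeakGradient u G ∧
      ∀ K : Set (RN N), IsCompact K → MemLp G 2 (volume.restrict K)

/-- `∇u ∈ H¹_loc(ℝ^N; ℝ^N)`: `u` has a weak gradient, all of whose components are in `H¹_loc`. -/
def GradMemH1Loc {N : ℕ} (u : RN N → ℝ) : Prop :=
  ∃ G : RN N → RN N, IsWeakGradient u G ∧ ∀ i : Fin N, MemH1Loc (fun x => G x i)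

/-- The Riesz potential `I_α` on `ℝ^N`. -/
noncomputable def rieszKernel (N : ℕ) (α : ℝ) (x : RN N) : ℝ :=
  Real.Gamma ((N - α) / 2) * ‖x‖ ^ (α - N) /
    (Real.pi ^ ((N : ℝ) / 2) * 2 ^ α * Real.Gamma (α / 2))

/-- The convolution `I_α * |u|^p`. -/
noncomputable def rieszConv {N : ℕ} (α p : ℝ) (u : RN N → ℝ) : RN N → ℝ :=
  convolution (rieszKernel N α) (fun y => |u y| ^ p) (ContinuousLinearMap.mul ℝ ℝ) volume

/-- The integral that defines `I_α * |u|^p` converges at almost every point. -/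
def RieszConvExists {N : ℕ} (α p : ℝ) (u : RN N → ℝ) : Prop :=
  ∀ᵐ x : RN N, ConvolutionExistsAt (rieszKernel N α) (fun y => |u y| ^ p) x
    (ContinuousLinearMap.mul ℝ ℝ) volume

/-- The right-hand side `q (I_α * |u|^p) |u|^(q-2) u + p (I_α * |u|^q) |u|^(p-2) u`.
The powers `|u|^(q-2) u` and `|u|^(p-2) u` are `0` where `u = 0`. -/
noncomputable def choquardRHS {N : ℕ} (α p q : ℝ) (u : RN N → ℝ) (x : RN N) : ℝ :=
  q * rieszConv α p u x * (|u x| ^ (q - 2) * u x) +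
    p * rieszConv α q u x * (|u x| ^ (p - 2) * u x)

/-- `u ∈ H¹(ℝ^N)` is a weak solution of
`-Δu + u = q (I_α * |u|^p) |u|^(q-2) u + p (I_α * |u|^q) |u|^(p-2) u` in `ℝ^N`:
the two convolutions are finite almost everywhere, the right-hand side is locally integrable, and
the equation holds when tested with smooth compactly supported functions. In the last clause,
`fderiv ℝ φ x (G x)` is the scalar product `∇φ(x) · ∇u(x)`. -/
structure IsChoquardSolution {N : ℕ} (α p q : ℝ) (u : RN N → ℝ) : Prop where
  memH1 : MemH1 u
  conv_left : RieszConvExists α p u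
  conv_right : RieszConvExists α q u
  locallyIntegrable_rhs : LocallyIntegrable (choquardRHS α p q u) volume
  weak_eq : ∃ G : RN N → RN N, IsWeakGradient u G ∧
    ∀ φ : RN N → ℝ, ContDiff ℝ ∞ φ → HasCompactSupport φ →
      (∫ x, fderiv ℝ φ x (G x)) + ∫ x, u x * φ x = ∫ x, choquardRHS α p q u x * φ x

/-!
The proof combines two identities. With `A = ∫ |∇u|²`, `B = ∫ u²` and
`E = ∫ (I_α * u ^ p) u ^ q`, testing the equation with `u` gives the Nehari identity
`A + B = (p + q) E`, and testing it with `x · ∇u` gives the Pohozaev identity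
`(N - 2) / 2 * A + N / 2 * B = (N + α) E` (`exists_nehari_pohozaev`). If
`p + q ≥ 2 (N + α) / (N - 2)`, eliminating `E` gives `B ≤ 0`. If `p + q ≤ 2 (N + α) / N`, it gives
`A ≤ 0`, so the gradient of `u` vanishes, and then `u = 0` because `u` is square integrable.

Since `∇u` is in `H¹_loc`, the equation holds almost everywhere and its right-hand side is in
`L²_loc`. Both terms of the right-hand side are nonnegative, because `u ≥ 0`, so each of them is in
`L²_loc`; this is what makes every integral below converge. For the same reason `E < ∞` comes out
of the Nehari identity with cutoffs by monotonicity (`integral_mul_self_of_laplacian`), with no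
appeal to the Hardy-Littlewood-Sobolev inequality, which would restrict `p` and `q`.

The local terms of the Pohozaev identity are integrations by parts against the cut off fields
`dilatedField N n`, whose derivatives are bounded uniformly in `n`
(`tendsto_integral_mul_dilatedField_of_laplacian`). For the nonlocal term the kernel
`|x - y| ^ (-β)`, `β = N - α`, is replaced by `(|x - y|² + ε²) ^ (-β / 2)`, and `u ^ q` by `F(u)`
with `F` of class `C¹` with bounded derivative. For fixed `y` this is an integration by parts in `x`
(`IsWeakPartial.integral_comp_mul_regKernel`), and all limits are dominated by the integrals already
known to converge. After symmetrisation in `x` and `y` the singular factor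
`(x - y) · (X(x) - X(y)) / |x - y|²` is bounded by the Lipschitz constant of `X`
(`integral_prod_rieszKernel_field`), and it tends to `1` as `X` exhausts the field `x ↦ x`.
-/

/-! ### Mollification and the chain rule for weak derivatives -/

open Filter Topology Metric in
/-- `L¹` convergence of mollifications, by Young's inequality and density of continuous functions
with compact support. -/
theorem tendsto_setIntegral_abs_mollify_sub_of_integrable {N : ℕ} {g : RN N → ℝ}
    (hg : Integrable g) (b : ℕ → ContDiffBump (0 : RN N))
    (hb : Tendsto (fun n => (b n).rOut) atTop (𝓝 0)) {K : Set (RN N)} (hK : IsCompact K) :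
    Tendsto (fun n => ∫ x in K, |convolution ((b n).normed volume) g
      (ContinuousLinearMap.lsmul ℝ ℝ) volume x - g x|) atTop (𝓝 0) := by
  set L := ContinuousLinearMap.lsmul ℝ ℝ (E := ℝ) with hL
  have hbi : ∀ n, Integrable ((b n).normed volume) := fun n => (b n).integrable_normed
  have young : ∀ n (w : RN N → ℝ), Integrable w →
      ∫ x, |convolution ((b n).normed volume) w L volume x| ≤ ∫ x, |w x| := by
    intro n w hw
    have h1 : ∫ x, convolution ((b n).normed volume) (fun x => |w x|) L volume x
        = ∫ x, |w x| := by
      rw [integral_convolution L (hbi n) hw.abs, (b n).integral_normed]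
      simp [hL]
    rw [← h1]
    refine integral_mono ((hbi n).integrable_convolution L hw).abs
      ((hbi n).integrable_convolution L hw.abs) fun x => ?_
    simp only [convolution_def]
    refine (abs_integral_le_integral_abs).trans (le_of_eq ?_)
    congr 1; ext t
    simp [hL, abs_mul, abs_of_nonneg ((b n).nonneg_normed t)]
  rw [Metric.tendsto_atTop]
  intro ε hε
  obtain ⟨h, hhc, hgh, hcont, hhi⟩ := hg.exists_hasCompactSupport_integral_sub_le
    (ε := ε / 4) (by positivity)
  have huc : UniformContinuous h := hhc.uniformContinuous_of_continuous hcont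
  set V := volume.real K with hV
  have hV0 : 0 ≤ V := measureReal_nonneg
  obtain ⟨δ, hδ, hδ'⟩ := Metric.uniformContinuous_iff.1 huc (ε / (4 * (V + 1))) (by positivity)
  obtain ⟨n₀, hn₀⟩ := Metric.tendsto_atTop.1 hb δ hδ
  refine ⟨n₀, fun n hn => ?_⟩
  have hr : (b n).rOut < δ := by
    have := hn₀ n hn
    rw [Real.dist_eq, sub_zero] at this
    exact (le_abs_self _).trans_lt this
  have hclose : ∀ x, |convolution ((b n).normed volume) h L volume x - h x|
      ≤ ε / (4 * (V + 1)) := by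
    intro x
    have := (b n).dist_normed_convolution_le (μ := volume) (x₀ := x) (g := h)
      (ε := ε / (4 * (V + 1))) hcont.aestronglyMeasurable
      (fun y hy => (hδ' ((mem_ball.1 hy).trans hr)).le)
    simpa [Real.dist_eq] using this
  have hgi := (hbi n).integrable_convolution L hg
  have hhi' := (hbi n).integrable_convolution L hhi
  have hpt : ∀ x, |convolution ((b n).normed volume) g L volume x - g x| ≤
      |convolution ((b n).normed volume) g L volume x
        - convolution ((b n).normed volume) h L volume x| + ε / (4 * (V + 1)) + |g x - h x| := by
    intro x
    have h1 := hclose x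
    have := abs_sub_comm (g x) (h x)
    calc _ = |(convolution ((b n).normed volume) g L volume x
        - convolution ((b n).normed volume) h L volume x) +
        (convolution ((b n).normed volume) h L volume x - h x) + (h x - g x)| := by ring_nf
      _ ≤ _ := (abs_add_three _ _ _).trans (by rw [this]; gcongr)
  have hae : ∀ᵐ x, convolution ((b n).normed volume) g L volume x
        - convolution ((b n).normed volume) h L volume x
        = convolution ((b n).normed volume) (g - h) L volume x := by
    filter_upwards [(hbi n).ae_convolution_exists L hg,
      (hbi n).ae_convolution_exists L hhi] with x h1 h2
    simp only [convolution_def]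
    rw [← integral_sub h1 h2]
    simp
  have I1 : Integrable (fun x => |convolution ((b n).normed volume) g L volume x
        - convolution ((b n).normed volume) h L volume x|) := (hgi.sub hhi').abs
  have I3 : Integrable (fun x => |g x - h x|) := (hg.sub hhi).abs
  have I2 : IntegrableOn (fun _ => ε / (4 * (V + 1))) K (volume : Measure (RN N)) :=
    continuousOn_const.integrableOn_compact hK
  have key : ∫ x in K, |convolution ((b n).normed volume) g L volume x - g x| ≤
      ε / 4 + ε / 4 + ε / 4 := by
    calc _ ≤ ∫ x in K, (|convolution ((b n).normed volume) g L volume x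
        - convolution ((b n).normed volume) h L volume x| + ε / (4 * (V + 1)) + |g x - h x|) :=
          integral_mono ((hgi.sub hg).abs.integrableOn)
            ((I1.integrableOn.add I2).add I3.integrableOn) hpt
      _ = (∫ x in K, |convolution ((b n).normed volume) g L volume x
        - convolution ((b n).normed volume) h L volume x|) + (∫ x in K, ε / (4 * (V + 1)))
          + ∫ x in K, |g x - h x| := by
            exact (integral_add (I1.integrableOn.add I2) I3.integrableOn).trans
              (congrArg (· + _) (integral_add I1.integrableOn I2))
      _ ≤ ε / 4 + ε / 4 + ε / 4 := by
        gcongr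
        · refine (setIntegral_le_integral I1 (ae_of_all _ fun _ => abs_nonneg _)).trans ?_
          have : ∫ x, |convolution ((b n).normed volume) g L volume x
              - convolution ((b n).normed volume) h L volume x| =
              ∫ x, |convolution ((b n).normed volume) (g - h) L volume x| := by
            refine integral_congr_ae ?_
            filter_upwards [hae] with x hx
            rw [hx]
          rw [this]
          refine (young n (g - h) (hg.sub hhi)).trans ?_
          simpa using hgh
        · rw [setIntegral_const, smul_eq_mul, ← hV]
          have : V * (ε / (4 * (V + 1))) = (V / (V + 1)) * (ε / 4) := by
            field_simp
          rw [this]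
          have : V / (V + 1) ≤ 1 := by
            rw [div_le_one (by positivity)]; linarith
          nlinarith
        · refine (setIntegral_le_integral I3 (ae_of_all _ fun _ => abs_nonneg _)).trans ?_
          simpa using hgh
  rw [Real.dist_eq, sub_zero, abs_of_nonneg (integral_nonneg fun _ => abs_nonneg _)]
  linarith

/-- Mollifications of a locally integrable function converge to it in `L¹` on compact sets. -/
theorem tendsto_setIntegral_abs_mollify_sub {N : ℕ} {g : RN N → ℝ}
    (hg : LocallyIntegrable g) (b : ℕ → ContDiffBump (0 : RN N))
    (hb : Filter.Tendsto (fun n => (b n).rOut) Filter.atTop (nhds 0)) {K : Set (RN N)}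
    (hK : IsCompact K) :
    Filter.Tendsto (fun n => ∫ x in K, |convolution ((b n).normed volume) g
      (ContinuousLinearMap.lsmul ℝ ℝ) volume x - g x|) Filter.atTop (nhds 0) := by
  have hK1 : IsCompact (Metric.cthickening 1 K) := hK.cthickening
  have hgi : Integrable ((Metric.cthickening 1 K).indicator g) :=
    (hg.integrableOn_isCompact hK1).integrable_indicator hK1.measurableSet
  refine (tendsto_setIntegral_abs_mollify_sub_of_integrable hgi b hb hK).congr' ?_
  filter_upwards [hb.eventually (gt_mem_nhds one_pos)] with n hn
  refine setIntegral_congr_fun hK.measurableSet fun x hx => ?_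
  have hx1 : x ∈ Metric.cthickening 1 K := Metric.self_subset_cthickening K hx
  have hc : convolution ((b n).normed volume) ((Metric.cthickening 1 K).indicator g)
      (ContinuousLinearMap.lsmul ℝ ℝ) volume x = convolution ((b n).normed volume) g
      (ContinuousLinearMap.lsmul ℝ ℝ) volume x := by
    simp only [convolution_def]
    congr 1; ext t
    by_cases ht : t ∈ Metric.ball (0 : RN N) (b n).rOut
    · have : x - t ∈ Metric.cthickening 1 K := by
        refine Metric.mem_cthickening_of_dist_le _ x _ _ hx ?_
        rw [dist_eq_norm]
        have : ‖t‖ < (b n).rOut := by simpa using ht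
        simpa using (this.trans hn).le
      rw [Set.indicator_of_mem this]
    · have : (b n).normed volume t = 0 := by
        rw [← Function.notMem_support, (b n).support_normed_eq]; exact ht
      simp [this]
  simp only [hc, Set.indicator_of_mem hx1]

/-- Convolution with a test function turns a weak derivative into a classical one. -/
theorem IsWeakPartial.fderiv_convolution {N : ℕ} {i : Fin N} {u v : RN N → ℝ}
    (h : IsWeakPartial i u v) {η : RN N → ℝ} (hη : ContDiff ℝ ∞ η) (hηc : HasCompactSupport η)
    (x : RN N) :
    fderiv ℝ (convolution η u (ContinuousLinearMap.lsmul ℝ ℝ) volume) x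
      (EuclideanSpace.single i 1) =
      convolution η v (ContinuousLinearMap.lsmul ℝ ℝ) volume x := by
  obtain ⟨hu, hv, hint⟩ := h
  have hd := hηc.hasFDerivAt_convolution_left (μ := volume)
    (ContinuousLinearMap.lsmul ℝ ℝ (E := ℝ)) (hη.of_le (by simp)) hu x
  rw [hd.fderiv]
  have hex : ConvolutionExistsAt (fderiv ℝ η) u x
      ((ContinuousLinearMap.lsmul ℝ ℝ (E := ℝ)).precompL (RN N)) volume :=
    (hηc.fderiv ℝ).convolutionExists_left _ (hη.continuous_fderiv (by simp)) hu x
  rw [convolution_def, ContinuousLinearMap.integral_apply hex, convolution_eq_swap]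
  have h1 : ∀ y, fderiv ℝ (fun y => η (x - y)) y (EuclideanSpace.single i 1) =
      - fderiv ℝ η (x - y) (EuclideanSpace.single i 1) := by
    intro y
    have : HasFDerivAt (fun y => η (x - y)) ((fderiv ℝ η (x - y)).comp
        (-(ContinuousLinearMap.id ℝ (RN N)))) y := by
      refine ((hη.differentiable (by simp)) (x - y)).hasFDerivAt.comp y ?_
      exact (hasFDerivAt_id y).const_sub x
    rw [this.fderiv]; simp
  have h2 := hint (fun y => η (x - y)) (hη.comp (contDiff_const.sub contDiff_id))
    (hηc.comp_homeomorph (Homeomorph.subLeft x))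
  simp only [h1, mul_neg, integral_neg, neg_inj] at h2
  rw [← integral_sub_left_eq_self _ volume x]
  simp only [ContinuousLinearMap.precompL_apply, ContinuousLinearMap.lsmul_apply, smul_eq_mul,
    sub_sub_cancel]
  simp only [mul_comm (η _) (v _), ← h2]
  simp only [mul_comm]

/-- A function with a weak partial derivative is approximated by smooth functions, almost
everywhere and together with the partial derivative in `L¹` on compact sets. -/
theorem IsWeakPartial.exists_smooth_approx {N : ℕ} {i : Fin N} {u v : RN N → ℝ}
    (h : IsWeakPartial i u v) : ∃ w : ℕ → RN N → ℝ, (∀ n, ContDiff ℝ ∞ (w n)) ∧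
      (∀ᵐ x, Filter.Tendsto (fun n => w n x) Filter.atTop (nhds (u x))) ∧
      (∀ K, IsCompact K →
        Filter.Tendsto (fun n => ∫ x in K, |w n x - u x|) Filter.atTop (nhds 0)) ∧
      ∀ K, IsCompact K → Filter.Tendsto (fun n => ∫ x in K,
        |fderiv ℝ (w n) x (EuclideanSpace.single i 1) - v x|) Filter.atTop (nhds 0) := by
  let b : ℕ → ContDiffBump (0 : RN N) := fun n =>
    ⟨1 / ((n : ℝ) + 1), 2 * (1 / ((n : ℝ) + 1)), by positivity, by
      have : 0 < 1 / ((n : ℝ) + 1) := by positivity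
      linarith⟩
  have hb : Filter.Tendsto (fun n => (b n).rOut) Filter.atTop (nhds 0) := by
    have := (tendsto_one_div_add_atTop_nhds_zero_nat (𝕜 := ℝ)).const_mul 2
    simpa [b] using this
  refine ⟨fun n => convolution ((b n).normed volume) u (ContinuousLinearMap.lsmul ℝ ℝ) volume,
    fun n => (b n).hasCompactSupport_normed.contDiff_convolution_left _ (b n).contDiff_normed h.1,
    ContDiffBump.ae_convolution_tendsto_right_of_locallyIntegrable (K := 2) hb
      (Filter.Eventually.of_forall fun n => le_rfl) h.1,
    fun K hK => tendsto_setIntegral_abs_mollify_sub h.1 b hb hK, fun K hK => ?_⟩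
  simp only [h.fderiv_convolution (b _).contDiff_normed (b _).hasCompactSupport_normed]
  exact tendsto_setIntegral_abs_mollify_sub h.2.1 b hb hK

theorem tendsto_integral_of_abs_sub_le {N : ℕ} {f : ℕ → RN N → ℝ} {f₀ : RN N → ℝ}
    {K : Set (RN N)} {d : ℕ → RN N → ℝ} {C : ℝ} (hK : MeasurableSet K)
    (hd : ∀ n, IntegrableOn (d n) K)
    (hlim : Filter.Tendsto (fun n => ∫ x in K, |d n x|) Filter.atTop (nhds 0))
    (hf : ∀ n, Integrable (f n)) (hf₀ : Integrable f₀)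
    (hle : ∀ n, ∀ x ∈ K, |f n x - f₀ x| ≤ C * |d n x|)
    (hout : ∀ n, ∀ x ∉ K, f n x = f₀ x) :
    Filter.Tendsto (fun n => ∫ x, f n x) Filter.atTop (nhds (∫ x, f₀ x)) := by
  rw [tendsto_iff_norm_sub_tendsto_zero]
  refine squeeze_zero (fun _ => norm_nonneg _) (fun n => ?_) (by simpa using hlim.const_mul C)
  rw [← integral_sub (hf n) hf₀, ← integral_const_mul]
  refine (norm_integral_le_integral_norm _).trans ?_
  rw [← setIntegral_eq_integral_of_forall_compl_eq_zero (s := K)]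
  · exact setIntegral_mono_on ((hf n).sub hf₀).norm.integrableOn ((hd n).abs.const_mul C) hK
      (fun x hx => hle n x hx)
  · intro x hx
    simp [hout n x hx]

theorem MeasureTheory.LocallyIntegrable.abs_of_real {N : ℕ} {u : RN N → ℝ}
    (h : LocallyIntegrable u) : LocallyIntegrable fun x => |u x| :=
  h.mono h.aestronglyMeasurable.norm (ae_of_all _ fun x => by simp)

/-- Chain rule for a `C¹` function with bounded derivative, by passing to the limit in the classical
chain rule for smooth approximations. -/
theorem IsWeakPartial.comp {N : ℕ} {i : Fin N} {u v : RN N → ℝ} (h : IsWeakPartial i u v)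
    {F g : ℝ → ℝ} (hF : ∀ t, HasDerivAt F (g t) t) (hg : Continuous g) {M : ℝ}
    (hM : ∀ t, |g t| ≤ M) :
    IsWeakPartial i (fun x => F (u x)) (fun x => g (u x) * v x) := by
  have hM0 : 0 ≤ M := (abs_nonneg _).trans (hM 0)
  have hFc : Continuous F := continuous_iff_continuousAt.2 fun t => (hF t).continuousAt
  have hFd : ContDiff ℝ 1 F := by
    refine contDiff_one_iff_deriv.2 ⟨fun t => (hF t).differentiableAt, ?_⟩
    rwa [show deriv F = g from funext fun t => (hF t).deriv]
  have hLip : ∀ s t, |F s - F t| ≤ M * |s - t| := by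
    intro s t
    have := Convex.norm_image_sub_le_of_norm_hasDerivWithin_le (f := F) (f' := g) (C := M)
      (s := Set.univ) (x := t) (y := s) (fun x _ => (hF x).hasDerivWithinAt)
      (fun x _ => hM x) convex_univ trivial trivial
    simpa using this
  have hFu : LocallyIntegrable (fun x => F (u x)) := by
    have hdom : LocallyIntegrable (fun x => |F 0| + M * |u x|) :=
      (continuous_const.locallyIntegrable).add (h.1.abs_of_real.smul M)
    refine hdom.mono (hFc.comp_aestronglyMeasurable h.1.aestronglyMeasurable)
      (ae_of_all _ fun x => ?_)
    rw [Real.norm_eq_abs, Real.norm_eq_abs,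
      abs_of_nonneg (a := |F 0| + M * |u x|) (by positivity)]
    have h1 := hLip (u x) 0
    have h2 := abs_sub_abs_le_abs_sub (F (u x)) (F 0)
    rw [sub_zero] at h1
    linarith
  have hgu : AEStronglyMeasurable (fun x => g (u x)) volume :=
    hg.comp_aestronglyMeasurable h.1.aestronglyMeasurable
  have hguv : LocallyIntegrable (fun x => g (u x) * v x) := by
    refine (h.2.1.abs_of_real.smul M).mono (hgu.mul h.2.1.aestronglyMeasurable)
      (ae_of_all _ fun x => ?_)
    simp only [Real.norm_eq_abs, Pi.smul_apply, smul_eq_mul, abs_mul, abs_abs, abs_of_nonneg hM0]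
    gcongr
    exact hM _
  refine ⟨hFu, hguv, fun φ hφ hφc => ?_⟩
  obtain ⟨w, hw, hae, hL1, hL1'⟩ := h.exists_smooth_approx
  set e : RN N := EuclideanSpace.single i 1
  set K := tsupport φ
  have hK : IsCompact K := hφc
  have hφ'c : Continuous fun x => fderiv ℝ φ x e :=
    (hφ.continuous_fderiv (by simp)).clm_apply continuous_const
  have hφ's : HasCompactSupport fun x => fderiv ℝ φ x e := hφc.fderiv_apply ℝ e
  have hφ'K : ∀ x ∉ K, fderiv ℝ φ x e = 0 := by
    intro x hx
    have : fderiv ℝ φ x = 0 := by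
      by_contra hne
      exact hx (support_fderiv_subset ℝ hne)
    simp [this]
  have hφK : ∀ x ∉ K, φ x = 0 := fun x hx => image_eq_zero_of_notMem_tsupport hx
  obtain ⟨C, hC⟩ := hφc.exists_bound_of_continuous hφ.continuous
  obtain ⟨C', hC'⟩ := hφ's.exists_bound_of_continuous hφ'c
  simp only [Real.norm_eq_abs] at hC hC'
  have hC0 : 0 ≤ C := (abs_nonneg _).trans (hC 0)
  have hwc : ∀ n, Continuous (w n) := fun n => (hw n).continuous
  have hw'c : ∀ n, Continuous fun x => fderiv ℝ (w n) x e := fun n =>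
    ((hw n).continuous_fderiv (by simp)).clm_apply continuous_const
  have lim1 : Filter.Tendsto (fun n => ∫ x, F (w n x) * fderiv ℝ φ x e) Filter.atTop
      (nhds (∫ x, F (u x) * fderiv ℝ φ x e)) := by
    refine tendsto_integral_of_abs_sub_le (d := fun n x => w n x - u x) (C := M * C')
      hK.measurableSet
      (fun n => ((hwc n).locallyIntegrable.sub h.1).integrableOn_isCompact hK) (hL1 K hK)
      (fun n => ((hFc.comp (hwc n)).mul hφ'c).integrable_of_hasCompactSupport hφ's.mul_left)
      (hFu.integrable_smul_right_of_hasCompactSupport hφ'c hφ's)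
      (fun n x hx => ?_) (fun n x hx => by simp [hφ'K x hx])
    rw [← sub_mul, abs_mul]
    calc _ ≤ (M * |w n x - u x|) * C' := by
          gcongr
          · exact hLip _ _
          · exact hC' x
      _ = _ := by ring
  have ibp : ∀ n, ∫ x, F (w n x) * fderiv ℝ φ x e =
      -∫ x, g (w n x) * fderiv ℝ (w n) x e * φ x := by
    intro n
    have hd : ∀ x, HasFDerivAt (fun x => F (w n x)) (g (w n x) • fderiv ℝ (w n) x) x := fun x =>
      (hF (w n x)).comp_hasFDerivAt x ((hw n).differentiable (by simp) x).hasFDerivAt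
    have hd' : ∀ x, fderiv ℝ (fun x => F (w n x)) x e = g (w n x) * fderiv ℝ (w n) x e := by
      intro x; rw [(hd x).fderiv]; simp
    have := integral_mul_fderiv_eq_neg_fderiv_mul_of_integrable (μ := volume) (v := e)
      (f := fun x => F (w n x)) (g := φ) (𝕜 := ℝ) ?_ ?_ ?_ (fun x _ => (hd x).differentiableAt)
      (fun x _ => hφ.differentiable (by simp) x)
    · simpa only [hd'] using this
    · simp only [hd']
      exact (((hg.comp (hwc n)).mul (hw'c n)).mul hφ.continuous).integrable_of_hasCompactSupport
        hφc.mul_left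
    · exact ((hFc.comp (hwc n)).mul hφ'c).integrable_of_hasCompactSupport hφ's.mul_left
    · exact ((hFc.comp (hwc n)).mul hφ.continuous).integrable_of_hasCompactSupport hφc.mul_left
  have hvφ : Integrable fun x => v x * φ x :=
    h.2.1.integrable_smul_right_of_hasCompactSupport hφ.continuous hφc
  have hgwv : ∀ n, Integrable fun x => g (w n x) * v x * φ x := fun n => by
    simp only [mul_assoc]
    exact hvφ.bdd_mul (hg.comp (hwc n)).aestronglyMeasurable
      (ae_of_all _ fun x => by simpa using hM (w n x))
  have hgv : Integrable fun x => g (u x) * v x * φ x := by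
    simp only [mul_assoc]
    exact hvφ.bdd_mul hgu (ae_of_all _ fun x => by simpa using hM (u x))
  have hgw' : ∀ n, Integrable fun x => g (w n x) * fderiv ℝ (w n) x e * φ x := fun n =>
    (((hg.comp (hwc n)).mul (hw'c n)).mul hφ.continuous).integrable_of_hasCompactSupport
        hφc.mul_left
  have lim2 : Filter.Tendsto (fun n => ∫ x, (g (w n x) * fderiv ℝ (w n) x e * φ x
      - g (w n x) * v x * φ x)) Filter.atTop (nhds (∫ _ : RN N, (0 : ℝ))) := by
    refine tendsto_integral_of_abs_sub_le (d := fun n x => fderiv ℝ (w n) x e - v x)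
      (C := M * C) hK.measurableSet
      (fun n => ((hw'c n).locallyIntegrable.sub h.2.1).integrableOn_isCompact hK) (hL1' K hK)
      (fun n => (hgw' n).sub (hgwv n)) (integrable_zero _ _ _)
      (fun n x hx => ?_) (fun n x hx => by simp [hφK x hx])
    rw [sub_zero, ← sub_mul, ← mul_sub, abs_mul, abs_mul]
    calc _ ≤ (M * |fderiv ℝ (w n) x e - v x|) * C := by
          gcongr
          · exact hM _
          · exact hC x
      _ = _ := by ring
  have lim3 : Filter.Tendsto (fun n => ∫ x, g (w n x) * v x * φ x) Filter.atTop
      (nhds (∫ x, g (u x) * v x * φ x)) := by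
    refine tendsto_integral_of_dominated_convergence (fun x => M * |v x * φ x|)
      (fun n => (hgwv n).aestronglyMeasurable) (hvφ.abs.const_mul M) (fun n => ?_) ?_
    · refine ae_of_all _ fun x => ?_
      rw [mul_assoc, norm_mul]
      exact mul_le_mul_of_nonneg_right (hM _) (abs_nonneg _)
    · filter_upwards [hae] with x hx
      exact (((hg.tendsto _).comp hx).mul_const _).mul_const _
  have lim4 := (lim2.add lim3).neg
  simp only [integral_zero, zero_add] at lim4
  refine tendsto_nhds_unique lim1 (lim4.congr fun n => ?_)
  rw [ibp n, integral_sub (hgw' n) (hgwv n)]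
  ring

/-! ### The product rule and second weak derivatives -/

theorem MeasureTheory.LocallyIntegrable.integrable_mul_right {N : ℕ} {u φ : RN N → ℝ}
    (hu : LocallyIntegrable u) (hφ : Continuous φ) (hφc : HasCompactSupport φ) :
    Integrable fun x => u x * φ x :=
  hu.integrable_smul_right_of_hasCompactSupport hφ hφc

theorem IsWeakPartial.add {N : ℕ} {i : Fin N} {u v u' v' : RN N → ℝ} (h : IsWeakPartial i u v)
    (h' : IsWeakPartial i u' v') :
    IsWeakPartial i (fun x => u x + u' x) (fun x => v x + v' x) := by
  refine ⟨h.1.add h'.1, h.2.1.add h'.2.1, fun φ hφ hφc => ?_⟩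
  have hφ'c : Continuous fun x => fderiv ℝ φ x (EuclideanSpace.single i 1) :=
    (hφ.continuous_fderiv (by simp)).clm_apply continuous_const
  have hφ's : HasCompactSupport fun x => fderiv ℝ φ x (EuclideanSpace.single i 1) :=
    hφc.fderiv_apply ℝ _
  simp only [add_mul]
  rw [integral_add (h.1.integrable_mul_right hφ'c hφ's)
    (h'.1.integrable_mul_right hφ'c hφ's),
    integral_add (h.2.1.integrable_mul_right hφ.continuous hφc)
    (h'.2.1.integrable_mul_right hφ.continuous hφc),
    h.2.2 φ hφ hφc, h'.2.2 φ hφ hφc]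
  ring

theorem IsWeakPartial.const_mul {N : ℕ} {i : Fin N} {u v : RN N → ℝ} (h : IsWeakPartial i u v)
    (c : ℝ) : IsWeakPartial i (fun x => c * u x) (fun x => c * v x) := by
  refine ⟨h.1.smul c, h.2.1.smul c, fun φ hφ hφc => ?_⟩
  simp only [mul_assoc, integral_const_mul, h.2.2 φ hφ hφc]
  ring

theorem IsWeakPartial.congr_ae {N : ℕ} {i : Fin N} {u v u' v' : RN N → ℝ}
    (h : IsWeakPartial i u v) (hu : u =ᵐ[volume] u') (hv : v =ᵐ[volume] v') :
    IsWeakPartial i u' v' := by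
  refine ⟨h.1.congr hu, h.2.1.congr hv, fun φ hφ hφc => ?_⟩
  rw [integral_congr_ae (g := fun x => u x * fderiv ℝ φ x (EuclideanSpace.single i 1)),
    h.2.2 φ hφ hφc, integral_congr_ae (f := fun x => v x * φ x) (g := fun x => v' x * φ x)]
  · filter_upwards [hv] with x hx
    rw [hx]
  · filter_upwards [hu] with x hx
    rw [hx]

/-- Square integrability on compact sets. -/
def L2Loc {N : ℕ} (f : RN N → ℝ) : Prop :=
  ∀ K : Set (RN N), IsCompact K → MemLp f 2 (volume.restrict K)

theorem L2Loc.add {N : ℕ} {f g : RN N → ℝ} (hf : L2Loc f) (hg : L2Loc g) :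
    L2Loc fun x => f x + g x := fun K hK => (hf K hK).add (hg K hK)

theorem L2Loc.const_mul {N : ℕ} {f : RN N → ℝ} (hf : L2Loc f) (c : ℝ) :
    L2Loc fun x => c * f x := fun K hK => (hf K hK).const_mul c

theorem L2Loc.congr_ae {N : ℕ} {f g : RN N → ℝ} (hf : L2Loc f) (h : f =ᵐ[volume] g) :
    L2Loc g := fun K hK => (hf K hK).ae_eq (ae_restrict_of_ae h)

theorem L2Loc.mul {N : ℕ} {f g : RN N → ℝ} (hf : L2Loc f) (hg : L2Loc g) :
    LocallyIntegrable fun x => f x * g x :=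
  locallyIntegrable_iff.2 fun K hK => (hf K hK).integrable_mul (hg K hK)

theorem MeasureTheory.MemLp.l2Loc {N : ℕ} {f : RN N → ℝ} (hf : MemLp f 2 volume) :
    L2Loc f := fun K _ => hf.restrict K

/-- The weak derivative of a square. -/
theorem IsWeakPartial.sq {N : ℕ} {i : Fin N} {u v : RN N → ℝ} (h : IsWeakPartial i u v)
    (hu : L2Loc u) (hv : L2Loc v) :
    IsWeakPartial i (fun x => u x ^ 2) (fun x => 2 * (u x * v x)) := by
  have huv := hu.mul hv
  have huu : LocallyIntegrable fun x => u x ^ 2 := by simpa only [pow_two] using hu.mul hu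
  refine ⟨huu, huv.smul (2 : ℝ), fun φ hφ hφc => ?_⟩
  set e : RN N := EuclideanSpace.single i 1
  have hφ'c : Continuous fun x => fderiv ℝ φ x e :=
    (hφ.continuous_fderiv (by simp)).clm_apply continuous_const
  have hφ's : HasCompactSupport fun x => fderiv ℝ φ x e := hφc.fderiv_apply ℝ e
  -- `t ^ 2` is replaced by the primitive of the truncation of `2 * t` at height `2 * k`.
  let g : ℕ → ℝ → ℝ := fun k s => 2 * max (-(k : ℝ)) (min s k)
  let F : ℕ → ℝ → ℝ := fun k t => ∫ s in (0 : ℝ)..t, g k s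
  have hgc : ∀ k, Continuous (g k) := fun k => by fun_prop
  have hF : ∀ k t, HasDerivAt (F k) (g k t) t := fun k t =>
    ((hgc k).integral_hasStrictDerivAt 0 t).hasDerivAt
  have hgM : ∀ k t, |g k t| ≤ 2 * k := by
    intro k t
    have hk : (0 : ℝ) ≤ k := k.cast_nonneg
    rw [abs_mul, abs_two]
    gcongr
    exact abs_le.2 ⟨le_max_left _ _, max_le (by linarith) (min_le_right _ _)⟩
  have hgle : ∀ k t, |g k t| ≤ 2 * |t| := by
    intro k t
    have hk : (0 : ℝ) ≤ k := k.cast_nonneg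
    rw [abs_mul, abs_two]
    refine mul_le_mul_of_nonneg_left ?_ zero_le_two
    refine abs_le.2 ⟨?_, max_le (by linarith [abs_nonneg t]) ((min_le_left _ _).trans
      (le_abs_self t))⟩
    rcases le_total t k with h' | h'
    · rw [min_eq_left h']; exact (neg_abs_le t).trans (le_max_right _ _)
    · rw [min_eq_right h']; exact (by linarith [abs_nonneg t] : -|t| ≤ (k : ℝ)).trans
        (le_max_right _ _)
  have hgeq : ∀ (k : ℕ) (t : ℝ), |t| ≤ k → g k t = 2 * t := by
    intro k t ht
    have := abs_le.1 ht
    simp only [g]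
    rw [min_eq_left this.2, max_eq_right this.1]
  have hFle : ∀ k t, |F k t| ≤ 2 * t ^ 2 := by
    intro k t
    have := intervalIntegral.norm_integral_le_of_norm_le_const (f := g k) (a := 0) (b := t)
      (C := 2 * |t|) (fun s hs => by
        refine (hgle k s).trans ?_
        have : |s| ≤ |t| := by
          rcases Set.mem_uIoc.1 hs with h' | h'
          · rw [abs_of_pos h'.1]; exact h'.2.trans (le_abs_self t)
          · rw [abs_of_nonpos h'.2, abs_of_neg (h'.1.trans_le h'.2)]; linarith [h'.1]
        linarith)
    rw [sub_zero, mul_assoc, abs_mul_abs_self, ← pow_two] at this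
    exact this
  have hFeq : ∀ (k : ℕ) (t : ℝ), |t| ≤ k → F k t = t ^ 2 := by
    intro k t ht
    have : F k t = ∫ s in (0 : ℝ)..t, 2 * s := by
      refine intervalIntegral.integral_congr fun s hs => hgeq k s ?_
      refine le_trans ?_ ht
      rcases Set.mem_uIcc.1 hs with h' | h'
      · rw [abs_of_nonneg h'.1]; exact h'.2.trans (le_abs_self t)
      · rw [abs_of_nonpos h'.2, abs_of_nonpos (h'.1.trans h'.2)]; linarith [h'.1]
    rw [this, intervalIntegral.integral_const_mul, integral_id]
    ring
  have hk := fun k => (h.comp (hF k) (hgc k) (hgM k)).2.2 φ hφ hφc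
  have hi1 : Integrable fun x => u x ^ 2 * fderiv ℝ φ x e :=
    huu.integrable_mul_right hφ'c hφ's
  have hi2 : Integrable fun x => u x * v x * φ x :=
    huv.integrable_mul_right hφ.continuous hφc
  have lim1 : Filter.Tendsto (fun k => ∫ x, F k (u x) * fderiv ℝ φ x e) Filter.atTop
      (nhds (∫ x, u x ^ 2 * fderiv ℝ φ x e)) := by
    refine tendsto_integral_of_dominated_convergence (fun x => 2 * |u x ^ 2 * fderiv ℝ φ x e|)
      (fun k => ((h.comp (hF k) (hgc k) (hgM k)).1.aestronglyMeasurable.mul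
        hφ'c.aestronglyMeasurable)) (hi1.abs.const_mul 2) (fun k => ae_of_all _ fun x => ?_)
      (ae_of_all _ fun x => ?_)
    · rw [Real.norm_eq_abs, abs_mul, abs_mul, abs_of_nonneg (sq_nonneg (u x)), ← mul_assoc]
      gcongr
      exact hFle k (u x)
    · refine tendsto_const_nhds.congr' ?_
      obtain ⟨k₀, hk₀⟩ := exists_nat_ge |u x|
      filter_upwards [Filter.eventually_ge_atTop k₀] with k hk
      rw [hFeq k (u x) (hk₀.trans (by exact_mod_cast hk))]
  have lim2 : Filter.Tendsto (fun k => -∫ x, g k (u x) * v x * φ x) Filter.atTop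
      (nhds (-∫ x, 2 * (u x * v x) * φ x)) := by
    refine Filter.Tendsto.neg ?_
    refine tendsto_integral_of_dominated_convergence (fun x => 2 * |u x * v x * φ x|)
      (fun k => ((h.comp (hF k) (hgc k) (hgM k)).2.1.aestronglyMeasurable.mul
        hφ.continuous.aestronglyMeasurable)) (hi2.abs.const_mul 2)
      (fun k => ae_of_all _ fun x => ?_) (ae_of_all _ fun x => ?_)
    · calc |g k (u x) * v x * φ x| = |g k (u x)| * |v x * φ x| := by rw [mul_assoc, abs_mul]
        _ ≤ 2 * |u x| * |v x * φ x| := by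
          gcongr
          exact hgle k (u x)
        _ = 2 * |u x * v x * φ x| := by rw [mul_assoc (u x), abs_mul (u x), mul_assoc]
    · refine tendsto_const_nhds.congr' ?_
      obtain ⟨k₀, hk₀⟩ := exists_nat_ge |u x|
      filter_upwards [Filter.eventually_ge_atTop k₀] with k hk
      rw [hgeq k (u x) (hk₀.trans (by exact_mod_cast hk))]
      ring
  exact tendsto_nhds_unique lim1 (lim2.congr fun k => (hk k).symm)

/-- The product rule in `H¹_loc`, by polarisation of the rule for squares. -/
theorem IsWeakPartial.mul {N : ℕ} {i : Fin N} {u v u' v' : RN N → ℝ} (h : IsWeakPartial i u v)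
    (h' : IsWeakPartial i u' v') (hu : L2Loc u) (hv : L2Loc v) (hu' : L2Loc u')
    (hv' : L2Loc v') :
    IsWeakPartial i (fun x => u x * u' x) (fun x => v x * u' x + u x * v' x) := by
  have hs := ((h.add h').sq (hu.add hu') (hv.add hv')).const_mul (1 / 4)
  have hd := ((h.add (h'.const_mul (-1))).sq (hu.add (hu'.const_mul _))
    (hv.add (hv'.const_mul _))).const_mul (-1 / 4)
  convert hs.add hd using 2 <;> ring

theorem IsWeakPartial.ae_unique {N : ℕ} {i : Fin N} {u v v' : RN N → ℝ}
    (h : IsWeakPartial i u v) (h' : IsWeakPartial i u v') : v =ᵐ[volume] v' := by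
  refine ae_eq_of_integral_contDiff_smul_eq h.2.1 h'.2.1 fun φ hφ hφc => ?_
  have h1 := h.2.2 φ hφ hφc
  rw [h'.2.2 φ hφ hφc, neg_inj] at h1
  simp only [smul_eq_mul, mul_comm (φ _), h1]

/-- Second weak derivatives commute. -/
theorem IsWeakPartial.ae_comm {N : ℕ} {i j : Fin N} {u vi vj hij hji : RN N → ℝ}
    (hi : IsWeakPartial i u vi) (hj : IsWeakPartial j u vj) (h1 : IsWeakPartial i vj hij)
    (h2 : IsWeakPartial j vi hji) : hij =ᵐ[volume] hji := by
  refine ae_eq_of_integral_contDiff_smul_eq h1.2.1 h2.2.1 fun φ hφ hφc => ?_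
  have hsm : ∀ k : Fin N, ContDiff ℝ ∞ fun x => fderiv ℝ φ x (EuclideanSpace.single k 1) :=
    fun k => (hφ.fderiv_right (by simp)).clm_apply contDiff_const
  have hcs : ∀ k : Fin N, HasCompactSupport fun x => fderiv ℝ φ x (EuclideanSpace.single k 1) :=
    fun k => hφc.fderiv_apply ℝ _
  have hcomm : ∀ x, fderiv ℝ (fun x => fderiv ℝ φ x (EuclideanSpace.single i 1)) x
      (EuclideanSpace.single j 1) = fderiv ℝ (fun x => fderiv ℝ φ x (EuclideanSpace.single j 1)) x
      (EuclideanSpace.single i 1) := by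
    intro x
    have hd : DifferentiableAt ℝ (fderiv ℝ φ) x :=
      (hφ.fderiv_right (m := ∞) (by simp)).differentiable (by simp) x
    rw [fderiv_clm_apply hd (differentiableAt_const _),
      fderiv_clm_apply hd (differentiableAt_const _)]
    have := (hφ.contDiffAt (x := x)).isSymmSndFDerivAt
      (by rw [minSmoothness_of_isRCLikeNormedField]; exact WithTop.coe_le_coe.2 le_top)
    simpa using (this (EuclideanSpace.single i 1) (EuclideanSpace.single j 1)).symm
  have e1 := h1.2.2 φ hφ hφc
  have e2 := h2.2.2 φ hφ hφc
  have e3 := hj.2.2 _ (hsm i) (hcs i)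
  have e4 := hi.2.2 _ (hsm j) (hcs j)
  simp only [hcomm] at e3
  simp only [smul_eq_mul, mul_comm (φ _)]
  linarith

/-! ### Testing the equation with cutoffs -/

theorem integrable_mul_fderiv_of_locallyIntegrable {N : ℕ} {w φ : RN N → ℝ}
    (hw : LocallyIntegrable w) (hφ : ContDiff ℝ ∞ φ) (hφc : HasCompactSupport φ) (e : RN N) :
    Integrable fun x => w x * fderiv ℝ φ x e :=
  hw.integrable_mul_right ((hφ.continuous_fderiv (by simp)).clm_apply continuous_const)
    (hφc.fderiv_apply ℝ e)

/-- The identity obtained by testing `-Δu + u = f` with `u ψ`, for a cutoff function `ψ`. -/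
theorem integral_mul_mul_test_of_laplacian {N : ℕ} {u f : RN N → ℝ} {G : Fin N → RN N → ℝ}
    {H : Fin N → Fin N → RN N → ℝ} (hG : ∀ i, IsWeakPartial i u (G i))
    (hH : ∀ i j, IsWeakPartial i (G j) (H i j)) (hu : L2Loc u) (hGl : ∀ i, L2Loc (G i))
    (hHl : ∀ i j, L2Loc (H i j)) (hf : ∀ᵐ x, f x = -∑ i, H i i x + u x)
    {ψ : RN N → ℝ} (hψ : ContDiff ℝ ∞ ψ) (hψc : HasCompactSupport ψ) :
    ∫ x, f x * u x * ψ x = (∑ i, ∫ x, G i x ^ 2 * ψ x) +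
      (∑ i, ∫ x, u x * G i x * fderiv ℝ ψ x (EuclideanSpace.single i 1)) +
      ∫ x, u x ^ 2 * ψ x := by
  have huu : Integrable fun x => u x ^ 2 * ψ x := by
    simpa only [pow_two] using (hu.mul hu).integrable_mul_right hψ.continuous hψc
  have hGG : ∀ i, Integrable fun x => G i x ^ 2 * ψ x := fun i => by
    simpa only [pow_two] using ((hGl i).mul (hGl i)).integrable_mul_right hψ.continuous hψc
  have huH : ∀ i, Integrable fun x => u x * H i i x * ψ x := fun i =>
    (hu.mul (hHl i i)).integrable_mul_right hψ.continuous hψc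
  have hprod : ∀ i, ∫ x, u x * G i x * fderiv ℝ ψ x (EuclideanSpace.single i 1) =
      -(∫ x, G i x ^ 2 * ψ x) - ∫ x, u x * H i i x * ψ x := by
    intro i
    have := ((hG i).mul (hH i i) hu (hGl i) (hGl i) (hHl i i)).2.2 ψ hψ hψc
    rw [this, neg_sub_left, neg_inj, add_comm, ← integral_add (hGG i) (huH i)]
    congr 1; ext x; ring
  have hL : ∫ x, f x * u x * ψ x =
      -(∑ i, ∫ x, u x * H i i x * ψ x) + ∫ x, u x ^ 2 * ψ x := by
    rw [← integral_finsetSum _ fun i _ => huH i, neg_add_eq_sub,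
      ← integral_sub huu (integrable_finsetSum _ fun i _ => huH i)]
    refine integral_congr_ae ?_
    filter_upwards [hf] with x hx
    rw [hx]
    simp only [mul_assoc, ← Finset.mul_sum, ← Finset.sum_mul]
    ring
  rw [hL, Finset.sum_congr rfl fun i _ => hprod i, Finset.sum_sub_distrib,
    Finset.sum_neg_distrib]
  ring

/-- The Pohozaev identity with a cutoff: the identity obtained by testing `-Δu + u = f` with
`X · ∇u`, for a compactly supported vector field `X`. -/
theorem integral_mul_field_of_laplacian {N : ℕ} {u f : RN N → ℝ} {G : Fin N → RN N → ℝ}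
    {H : Fin N → Fin N → RN N → ℝ} (hG : ∀ i, IsWeakPartial i u (G i))
    (hH : ∀ i j, IsWeakPartial i (G j) (H i j)) (hu : L2Loc u) (hGl : ∀ i, L2Loc (G i))
    (hHl : ∀ i j, L2Loc (H i j)) (hf : ∀ᵐ x, f x = -∑ i, H i i x + u x)
    {X : Fin N → RN N → ℝ} (hX : ∀ j, ContDiff ℝ ∞ (X j)) (hXc : ∀ j, HasCompactSupport (X j)) :
    ∫ x, f x * ∑ j, G j x * X j x =
      (∑ i, ∑ j, ∫ x, G i x * G j x * fderiv ℝ (X j) x (EuclideanSpace.single i 1))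
      - (1 / 2) * (∑ i, ∑ j, ∫ x, G i x ^ 2 * fderiv ℝ (X j) x (EuclideanSpace.single j 1))
      - (1 / 2) * ∑ j, ∫ x, u x ^ 2 * fderiv ℝ (X j) x (EuclideanSpace.single j 1) := by
  have hHG : ∀ i j k l, Integrable fun x => H i j x * G k x * X l x := fun i j k l =>
    ((hHl i j).mul (hGl k)).integrable_mul_right (hX l).continuous (hXc l)
  have huG : ∀ j, Integrable fun x => u x * G j x * X j x := fun j =>
    (hu.mul (hGl j)).integrable_mul_right (hX j).continuous (hXc j)
  have e1 : ∀ i j, ∫ x, G i x * G j x * fderiv ℝ (X j) x (EuclideanSpace.single i 1) =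
      -(∫ x, H i i x * G j x * X j x) - ∫ x, H i j x * G i x * X j x := by
    intro i j
    have := ((hH i i).mul (hH i j) (hGl i) (hHl i i) (hGl j) (hHl i j)).2.2 (X j) (hX j) (hXc j)
    rw [this, neg_sub_left, neg_inj, add_comm, ← integral_add (hHG _ _ _ _) (hHG _ _ _ _)]
    congr 1; ext x; ring
  have e2 : ∀ i j, ∫ x, G i x ^ 2 * fderiv ℝ (X j) x (EuclideanSpace.single j 1) =
      -2 * ∫ x, H i j x * G i x * X j x := by
    intro i j
    rw [((hH j i).sq (hGl i) (hHl j i)).2.2 (X j) (hX j) (hXc j), ← integral_const_mul,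
      ← integral_neg]
    refine integral_congr_ae ?_
    filter_upwards [(hG j).ae_comm (hG i) (hH j i) (hH i j)] with x hx
    rw [hx]; ring
  have e3 : ∀ j, ∫ x, u x ^ 2 * fderiv ℝ (X j) x (EuclideanSpace.single j 1) =
      -2 * ∫ x, u x * G j x * X j x := by
    intro j
    rw [((hG j).sq hu (hGl j)).2.2 (X j) (hX j) (hXc j), ← integral_const_mul, ← integral_neg]
    congr 1; ext x; ring
  have hL : ∫ x, f x * ∑ j, G j x * X j x =
      -(∑ i, ∑ j, ∫ x, H i i x * G j x * X j x) + ∑ j, ∫ x, u x * G j x * X j x := by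
    have : ∀ i, ∑ j, ∫ x, H i i x * G j x * X j x = ∫ x, ∑ j, H i i x * G j x * X j x :=
      fun i => (integral_finsetSum _ fun j _ => hHG i i j j).symm
    simp only [this]
    rw [← integral_finsetSum _ fun i _ => integrable_finsetSum _ fun j _ => hHG i i j j,
      ← integral_finsetSum _ fun j _ => huG j, neg_add_eq_sub, ← integral_sub
      (integrable_finsetSum _ fun j _ => huG j)
      (integrable_finsetSum _ fun i _ => integrable_finsetSum _ fun j _ => hHG i i j j)]
    refine integral_congr_ae ?_
    filter_upwards [hf] with x hx
    rw [hx]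
    simp only [mul_assoc, ← Finset.mul_sum, ← Finset.sum_mul]
    ring
  rw [hL]
  simp only [e1, e2, e3, Finset.sum_sub_distrib, Finset.sum_neg_distrib, ← Finset.mul_sum]
  ring

/-- A smooth function equal to `1` on the ball of radius `n + 1`, obtained from a fixed bump
function by dilation. -/
noncomputable def dilatedCutoff (N n : ℕ) (x : RN N) : ℝ :=
  (⟨1, 2, one_pos, one_lt_two⟩ : ContDiffBump (0 : RN N)) (((n : ℝ) + 1)⁻¹ • x)

/-- The vector field `x ↦ x`, cut off outside a ball of radius comparable to `n + 1`. -/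
noncomputable def dilatedField (N n : ℕ) (x : RN N) : RN N := dilatedCutoff N n x • x

theorem contDiff_dilatedCutoff (N n : ℕ) : ContDiff ℝ ∞ (dilatedCutoff N n) :=
  (ContDiffBump.contDiff _).comp (contDiff_const_smul _)

theorem hasCompactSupport_dilatedCutoff (N n : ℕ) : HasCompactSupport (dilatedCutoff N n) :=
  (ContDiffBump.hasCompactSupport _).comp_smul (by positivity)

theorem dilatedCutoff_nonneg (N n : ℕ) (x : RN N) : 0 ≤ dilatedCutoff N n x :=
  ContDiffBump.nonneg _

theorem dilatedCutoff_le_one (N n : ℕ) (x : RN N) : dilatedCutoff N n x ≤ 1 :=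
  ContDiffBump.le_one _

theorem dilatedCutoff_eq_one {N n : ℕ} {x : RN N} (hx : ‖x‖ ≤ n + 1) :
    dilatedCutoff N n x = 1 := by
  refine ContDiffBump.one_of_mem_closedBall _ ?_
  rw [mem_closedBall_zero_iff, norm_smul, norm_inv, Real.norm_eq_abs,
    abs_of_pos (by positivity : (0 : ℝ) < n + 1)]
  exact inv_mul_le_one_of_le₀ hx (by positivity)

theorem eventually_dilatedCutoff_eventuallyEq_one {N : ℕ} (x : RN N) :
    ∀ᶠ n in Filter.atTop, dilatedCutoff N n =ᶠ[nhds x] fun _ => 1 := by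
  obtain ⟨n₀, hn₀⟩ := exists_nat_gt ‖x‖
  filter_upwards [Filter.eventually_ge_atTop n₀] with n hn
  have hx : ‖x‖ < n := hn₀.trans_le (by exact_mod_cast hn)
  filter_upwards [continuous_norm.continuousAt.eventually (gt_mem_nhds hx)] with y hy
  exact dilatedCutoff_eq_one (by linarith)

theorem fderiv_dilatedCutoff_eventually {N : ℕ} (x : RN N) :
    ∀ᶠ n in Filter.atTop, fderiv ℝ (dilatedCutoff N n) x = 0 := by
  filter_upwards [eventually_dilatedCutoff_eventuallyEq_one x] with n hn
  rw [hn.fderiv_eq]; simp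

theorem fderiv_dilatedField_eventually {N : ℕ} (x : RN N) :
    ∀ᶠ n in Filter.atTop, fderiv ℝ (dilatedField N n) x = ContinuousLinearMap.id ℝ (RN N) := by
  filter_upwards [eventually_dilatedCutoff_eventuallyEq_one x] with n hn
  have : dilatedField N n =ᶠ[nhds x] id := by
    filter_upwards [hn] with y hy
    simp [dilatedField, hy]
  rw [this.fderiv_eq]; simp

theorem dilatedField_eventually {N : ℕ} (x : RN N) :
    ∀ᶠ n in Filter.atTop, dilatedField N n x = x := by
  filter_upwards [eventually_dilatedCutoff_eventuallyEq_one x] with n hn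
  simp [dilatedField, hn.eq_of_nhds]

theorem contDiff_dilatedField (N n : ℕ) : ContDiff ℝ ∞ (dilatedField N n) :=
  (contDiff_dilatedCutoff N n).smul contDiff_id

theorem hasCompactSupport_dilatedField (N n : ℕ) : HasCompactSupport (dilatedField N n) :=
  (hasCompactSupport_dilatedCutoff N n).smul_right

theorem exists_norm_fderiv_dilatedCutoff_le (N : ℕ) :
    ∃ C, ∀ n x, ‖fderiv ℝ (dilatedCutoff N n) x‖ ≤ C := by
  obtain ⟨C, hC⟩ := ((hasCompactSupport_dilatedCutoff N 0).fderiv ℝ).exists_bound_of_continuous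
    ((contDiff_dilatedCutoff N 0).continuous_fderiv (by simp))
  refine ⟨C, fun n x => ?_⟩
  have h : dilatedCutoff N n = fun x => dilatedCutoff N 0 (((n : ℝ) + 1)⁻¹ • x) := by
    ext x; simp [dilatedCutoff]
  rw [h, fderiv_comp_smul, norm_smul, norm_inv, Real.norm_eq_abs,
    abs_of_pos (by positivity : (0 : ℝ) < n + 1)]
  refine (mul_le_of_le_one_left (norm_nonneg _) ?_).trans (hC _)
  exact inv_le_one_of_one_le₀ (by linarith [n.cast_nonneg (α := ℝ)])

theorem fderiv_smul_comp_inv_smul {N : ℕ} {F : RN N → RN N} (hF : Differentiable ℝ F) {c : ℝ}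
    (hc : c ≠ 0) (x : RN N) :
    fderiv ℝ (fun y => c • F (c⁻¹ • y)) x = fderiv ℝ F (c⁻¹ • x) := by
  have h1 : HasFDerivAt (fun y : RN N => c⁻¹ • y) (c⁻¹ • ContinuousLinearMap.id ℝ (RN N)) x :=
    (c⁻¹ • ContinuousLinearMap.id ℝ (RN N)).hasFDerivAt
  have h2 := ((hF (c⁻¹ • x)).hasFDerivAt.comp x h1).const_smul c
  refine h2.fderiv.trans ?_
  ext1 v
  simp [smul_smul, hc]

theorem exists_norm_fderiv_dilatedField_le (N : ℕ) :
    ∃ C, ∀ n x, ‖fderiv ℝ (dilatedField N n) x‖ ≤ C := by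
  obtain ⟨C, hC⟩ := ((hasCompactSupport_dilatedField N 0).fderiv ℝ).exists_bound_of_continuous
    ((contDiff_dilatedField N 0).continuous_fderiv (by simp))
  refine ⟨C, fun n x => ?_⟩
  have hn : (n : ℝ) + 1 ≠ 0 := by positivity
  have h : dilatedField N n =
      fun x => ((n : ℝ) + 1) • dilatedField N 0 (((n : ℝ) + 1)⁻¹ • x) := by
    ext1 x
    simp only [dilatedField, dilatedCutoff, CharP.cast_eq_zero, zero_add, inv_one, one_smul]
    rw [smul_comm, smul_inv_smul₀ hn]
  rw [h, fderiv_smul_comp_inv_smul ((contDiff_dilatedField N 0).differentiable (by simp)) hn]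
  exact hC _

/-! ### Removing the cutoffs: the local terms -/

theorem ContDiff.euclideanSpace_apply {N : ℕ} {X : RN N → RN N} (hX : ContDiff ℝ ∞ X)
    (j : Fin N) : ContDiff ℝ ∞ fun x => X x j :=
  (contDiff_piLp_apply 2).comp hX

theorem HasCompactSupport.euclideanSpace_apply {N : ℕ} {X : RN N → RN N}
    (hXc : HasCompactSupport X) (j : Fin N) : HasCompactSupport fun x => X x j :=
  hXc.comp_left (g := fun y : RN N => y j) rfl

theorem fderiv_euclideanSpace_apply {N : ℕ} {F : RN N → RN N} {x : RN N}
    (hF : DifferentiableAt ℝ F x) (j : Fin N) (v : RN N) :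
    fderiv ℝ (fun x => F x j) x v = fderiv ℝ F x v j := by
  have h : HasFDerivAt (fun x => F x j)
    ((EuclideanSpace.proj j : RN N →L[ℝ] ℝ).comp (fderiv ℝ F x)) x :=
    (EuclideanSpace.proj j : RN N →L[ℝ] ℝ).hasFDerivAt.comp x hF.hasFDerivAt
  rw [h.fderiv]
  simp

theorem tendsto_integral_mul_fderiv_dilatedField {N : ℕ} {w : RN N → ℝ} (hw : Integrable w)
    (i j : Fin N) :
    Filter.Tendsto (fun n => ∫ x, w x * fderiv ℝ (fun x => dilatedField N n x j) x
      (EuclideanSpace.single i 1)) Filter.atTop (nhds (if i = j then ∫ x, w x else 0)) := by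
  obtain ⟨C, hC⟩ := exists_norm_fderiv_dilatedField_le N
  have hd : ∀ n x, fderiv ℝ (fun x => dilatedField N n x j) x (EuclideanSpace.single i 1) =
      fderiv ℝ (dilatedField N n) x (EuclideanSpace.single i 1) j := fun n x =>
    fderiv_euclideanSpace_apply ((contDiff_dilatedField N n).differentiable (by simp) x) j _
  have hlim : (if i = j then ∫ x, w x else 0) =
      ∫ x, w x * (EuclideanSpace.single i (1 : ℝ) : RN N) j := by
    by_cases h : i = j <;> simp [h, eq_comm]
  rw [hlim]
  refine tendsto_integral_of_dominated_convergence (fun x => |w x| * C) (fun n => ?_)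
    (hw.abs.mul_const C) (fun n => ae_of_all _ fun x => ?_) (ae_of_all _ fun x => ?_)
  · exact hw.aestronglyMeasurable.mul
      ((((contDiff_dilatedField N n).euclideanSpace_apply j).continuous_fderiv (by simp)).clm_apply
        continuous_const).aestronglyMeasurable
  · rw [hd, norm_mul]
    refine mul_le_mul_of_nonneg_left ?_ (norm_nonneg _)
    refine (PiLp.norm_apply_le _ j).trans ((ContinuousLinearMap.le_opNorm _ _).trans ?_)
    simpa using hC n x
  · refine tendsto_const_nhds.congr' ?_
    filter_upwards [fderiv_dilatedField_eventually x] with n hn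
    rw [hd, hn]; rfl

theorem tendsto_integral_mul_dilatedCutoff {N : ℕ} {w : RN N → ℝ} (hw : Integrable w) :
    Filter.Tendsto (fun n => ∫ x, w x * dilatedCutoff N n x) Filter.atTop
      (nhds (∫ x, w x)) := by
  refine tendsto_integral_of_dominated_convergence (fun x => |w x|) (fun n => ?_) hw.abs
    (fun n => ae_of_all _ fun x => ?_) (ae_of_all _ fun x => ?_)
  · exact hw.aestronglyMeasurable.mul (contDiff_dilatedCutoff N n).continuous.aestronglyMeasurable
  · rw [norm_mul, Real.norm_of_nonneg (dilatedCutoff_nonneg N n x)]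
    exact mul_le_of_le_one_right (abs_nonneg _) (dilatedCutoff_le_one N n x)
  · refine tendsto_const_nhds.congr' ?_
    filter_upwards [eventually_dilatedCutoff_eventuallyEq_one x] with n hn
    rw [hn.eq_of_nhds, mul_one]

theorem tendsto_integral_mul_fderiv_dilatedCutoff {N : ℕ} {w : RN N → ℝ} (hw : Integrable w)
    (i : Fin N) :
    Filter.Tendsto (fun n => ∫ x, w x * fderiv ℝ (dilatedCutoff N n) x
      (EuclideanSpace.single i 1)) Filter.atTop (nhds 0) := by
  obtain ⟨C, hC⟩ := exists_norm_fderiv_dilatedCutoff_le N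
  have hlim : (0 : ℝ) = ∫ _ : RN N, (0 : ℝ) := by simp
  rw [hlim]
  refine tendsto_integral_of_dominated_convergence (fun x => |w x| * C) (fun n => ?_)
    (hw.abs.mul_const C) (fun n => ae_of_all _ fun x => ?_) (ae_of_all _ fun x => ?_)
  · exact hw.aestronglyMeasurable.mul (((contDiff_dilatedCutoff N n).continuous_fderiv
      (by simp)).clm_apply continuous_const).aestronglyMeasurable
  · rw [norm_mul]
    refine mul_le_mul_of_nonneg_left ?_ (norm_nonneg _)
    refine (ContinuousLinearMap.le_opNorm _ _).trans ?_
    simpa using hC n x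
  · refine tendsto_const_nhds.congr' ?_
    filter_upwards [fderiv_dilatedCutoff_eventually x] with n hn
    simp [hn]

/-- The Nehari identity: if `f u ≥ 0`, then `-Δu + u = f` tested with `u` shows that `f u` is
integrable and computes its integral. -/
theorem integral_mul_self_of_laplacian {N : ℕ} {u f : RN N → ℝ} {G : Fin N → RN N → ℝ}
    {H : Fin N → Fin N → RN N → ℝ} (hG : ∀ i, IsWeakPartial i u (G i))
    (hH : ∀ i j, IsWeakPartial i (G j) (H i j)) (hu : MemLp u 2 volume)
    (hG2 : ∀ i, MemLp (G i) 2 volume) (hHl : ∀ i j, L2Loc (H i j))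
    (hf : ∀ᵐ x, f x = -∑ i, H i i x + u x) (hfl : L2Loc f) (hfu : ∀ᵐ x, 0 ≤ f x * u x) :
    (Integrable fun x => f x * u x) ∧
      ∫ x, f x * u x = (∑ i, ∫ x, G i x ^ 2) + ∫ x, u x ^ 2 := by
  have hid := fun n => integral_mul_mul_test_of_laplacian hG hH hu.l2Loc (fun i => (hG2 i).l2Loc)
    hHl hf (contDiff_dilatedCutoff N n) (hasCompactSupport_dilatedCutoff N n)
  have huG : ∀ i, Integrable fun x => u x * G i x := fun i => hu.integrable_mul (hG2 i)
  have hlim : Filter.Tendsto (fun n => ∫ x, f x * u x * dilatedCutoff N n x) Filter.atTop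
      (nhds ((∑ i, ∫ x, G i x ^ 2) + ∫ x, u x ^ 2)) := by
    simp only [hid]
    have h1 := tendsto_finsetSum Finset.univ fun i _ =>
      tendsto_integral_mul_dilatedCutoff (hG2 i).integrable_sq
    have h2 := tendsto_finsetSum Finset.univ fun i _ =>
      tendsto_integral_mul_fderiv_dilatedCutoff (huG i) i
    have h3 := tendsto_integral_mul_dilatedCutoff hu.integrable_sq
    simpa using (h1.add h2).add h3
  have hloc : LocallyIntegrable fun x => f x * u x := hfl.mul hu.l2Loc
  have hint : Integrable fun x => f x * u x := by
    obtain ⟨I, hI⟩ := hlim.isBoundedUnder_le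
    rw [Filter.eventually_map] at hI
    refine (aecover_closedBall (x := (0 : RN N)) (μ := volume) (l := Filter.atTop)
      (r := fun n : ℕ => (n : ℝ))
      tendsto_natCast_atTop_atTop).integrable_of_integral_bounded_of_nonneg_ae I
      (fun n => hloc.integrableOn_isCompact (isCompact_closedBall _ _)) hfu ?_
    filter_upwards [hI] with n hn
    refine le_trans ?_ hn
    have hint := hloc.integrable_mul_right (contDiff_dilatedCutoff N n).continuous
      (hasCompactSupport_dilatedCutoff N n)
    calc ∫ x in Metric.closedBall 0 (n : ℝ), f x * u x
        = ∫ x in Metric.closedBall 0 (n : ℝ), f x * u x * dilatedCutoff N n x := by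
          refine setIntegral_congr_fun Metric.isClosed_closedBall.measurableSet fun x hx => ?_
          have : ‖x‖ ≤ n := by simpa using hx
          rw [dilatedCutoff_eq_one (by linarith), mul_one]
      _ ≤ _ := setIntegral_le_integral hint (by
          filter_upwards [hfu] with x hx
          exact mul_nonneg hx (dilatedCutoff_nonneg N n x))
  exact ⟨hint, tendsto_nhds_unique (tendsto_integral_mul_dilatedCutoff hint) hlim⟩

/-- The local part of the Pohozaev identity: the limit of `∫ f X · ∇u` as the cut off fields `X`
exhaust the field `x ↦ x`. -/
theorem tendsto_integral_mul_dilatedField_of_laplacian {N : ℕ} {u f : RN N → ℝ}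
    {G : Fin N → RN N → ℝ} {H : Fin N → Fin N → RN N → ℝ} (hG : ∀ i, IsWeakPartial i u (G i))
    (hH : ∀ i j, IsWeakPartial i (G j) (H i j)) (hu : MemLp u 2 volume)
    (hG2 : ∀ i, MemLp (G i) 2 volume) (hHl : ∀ i j, L2Loc (H i j))
    (hf : ∀ᵐ x, f x = -∑ i, H i i x + u x) :
    Filter.Tendsto (fun n => ∫ x, f x * ∑ j, G j x * dilatedField N n x j) Filter.atTop
      (nhds ((∑ i, ∫ x, G i x ^ 2) - (N / 2) * (∑ i, ∫ x, G i x ^ 2)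
        - (N / 2) * ∫ x, u x ^ 2)) := by
  have hid := fun n => integral_mul_field_of_laplacian hG hH hu.l2Loc (fun i => (hG2 i).l2Loc)
    hHl hf (fun j => (contDiff_dilatedField N n).euclideanSpace_apply j)
    (fun j => (hasCompactSupport_dilatedField N n).euclideanSpace_apply j)
  simp only [hid]
  have h1 := tendsto_finsetSum Finset.univ fun i _ => tendsto_finsetSum Finset.univ fun j _ =>
    tendsto_integral_mul_fderiv_dilatedField ((hG2 i).integrable_mul (hG2 j)) i j
  have h2 := tendsto_finsetSum Finset.univ fun i _ => tendsto_finsetSum Finset.univ fun j _ =>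
    tendsto_integral_mul_fderiv_dilatedField (hG2 i).integrable_sq j j
  have h3 := tendsto_finsetSum Finset.univ fun j _ =>
    tendsto_integral_mul_fderiv_dilatedField hu.integrable_sq j j
  have h := (h1.sub (h2.const_mul (1 / 2))).sub (h3.const_mul (1 / 2))
  have e : (∑ i, ∑ j, if i = j then ∫ x, G i x * G j x else 0) = ∑ i, ∫ x, G i x ^ 2 := by
    simp [pow_two]
  simp only [e, if_true, Finset.sum_const, Finset.card_univ, Fintype.card_fin, nsmul_eq_mul,
    ← Finset.mul_sum, Pi.mul_apply] at h
  refine h.trans (le_of_eq ?_)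
  congr 1
  ring

/-- A square integrable function with vanishing weak gradient has norm zero: the limit of the
identity `∫ u² ∂ⱼXⱼ = -2 ∫ u ∂ⱼu Xⱼ = 0` as `X` exhausts the field `x ↦ x`. -/
theorem integral_sq_eq_zero_of_weakGradient_eq_zero {N : ℕ} (hN : 0 < N) {u : RN N → ℝ}
    {G : Fin N → RN N → ℝ} (hG : ∀ i, IsWeakPartial i u (G i)) (hu : MemLp u 2 volume)
    (hG2 : ∀ i, MemLp (G i) 2 volume) (h0 : ∀ i, G i =ᵐ[volume] 0) :
    ∫ x, u x ^ 2 = 0 := by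
  have hlim := tendsto_integral_mul_fderiv_dilatedField hu.integrable_sq
    (⟨0, hN⟩ : Fin N) ⟨0, hN⟩
  rw [if_pos rfl] at hlim
  refine tendsto_nhds_unique hlim (tendsto_const_nhds.congr fun n => ?_)
  rw [((hG ⟨0, hN⟩).sq hu.l2Loc (hG2 _).l2Loc).2.2 _
    ((contDiff_dilatedField N n).euclideanSpace_apply _)
    ((hasCompactSupport_dilatedField N n).euclideanSpace_apply _), eq_comm, neg_eq_zero]
  refine integral_eq_zero_of_ae ?_
  filter_upwards [h0 ⟨0, hN⟩] with x hx
  simp [hx]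

/-! ### Approximation of powers and of the Riesz kernel -/

/-- The power `t ^ q` on `[0, ∞)` is the increasing limit of `C¹` functions with bounded
derivatives, whose derivatives are dominated by that of `t ^ q`. Truncation is needed near `0`
(when `q < 1`) and near `∞` (when `q > 1`). -/
theorem exists_approx_rpow {q : ℝ} (hq : 0 < q) : ∃ F g : ℕ → ℝ → ℝ,
    (∀ k t, HasDerivAt (F k) (g k t) t) ∧ (∀ k, Continuous (g k)) ∧
    (∀ k, ∃ M, ∀ t, |g k t| ≤ M) ∧
    (∀ k t, 0 ≤ t → |g k t| ≤ q * (t ^ (q - 2) * t)) ∧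
    (∀ k t, 0 ≤ t → |F k t| ≤ t ^ q) ∧
    (∀ t, 0 ≤ t → Filter.Tendsto (fun k => g k t) Filter.atTop
      (nhds (q * (t ^ (q - 2) * t)))) ∧
    ∀ t, 0 ≤ t → Filter.Tendsto (fun k => F k t) Filter.atTop (nhds (t ^ q)) := by
  let ε : ℕ → ℝ := fun k => ((k : ℝ) + 1)⁻¹
  have hε : ∀ k, 0 < ε k := fun k => by positivity
  let χ : ℕ → ℝ → ℝ := fun k s =>
    min 1 (max 0 (((k : ℝ) + 1) * s - 1)) * min 1 (max 0 ((k : ℝ) + 1 - s))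
  have hχ0 : ∀ k s, 0 ≤ χ k s := fun k s => by positivity
  have hχ1 : ∀ k s, χ k s ≤ 1 := fun k s =>
    mul_le_one₀ (min_le_left _ _) (by positivity) (min_le_left _ _)
  have hχsmall : ∀ k s, s ≤ ε k → χ k s = 0 := by
    intro k s hs
    have : ((k : ℝ) + 1) * s ≤ 1 := by
      calc ((k : ℝ) + 1) * s ≤ ((k : ℝ) + 1) * ε k := by gcongr
        _ = 1 := mul_inv_cancel₀ (by positivity)
    simp only [χ]
    rw [max_eq_left (by linarith)]; simp
  have hχlarge : ∀ (k : ℕ) (s : ℝ), (k : ℝ) + 1 ≤ s → χ k s = 0 := by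
    intro k s hs
    simp only [χ]
    rw [max_eq_left (a := (0 : ℝ)) (b := (k : ℝ) + 1 - s) (by linarith)]; simp
  let g : ℕ → ℝ → ℝ := fun k s => q * (max s (ε k)) ^ (q - 1) * χ k s
  have hgc : ∀ k, Continuous (g k) := by
    intro k
    have h1 : Continuous fun s => (max s (ε k)) ^ (q - 1) :=
      (continuous_id.max continuous_const).rpow_const fun s =>
        Or.inl (((hε k).trans_le (le_max_right _ _)).ne')
    have h2 : Continuous (χ k) := by fun_prop
    exact (continuous_const.mul h1).mul h2
  have hpow : ∀ t : ℝ, 0 < t → t ^ (q - 2) * t = t ^ (q - 1) := by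
    intro t ht
    rw [← Real.rpow_add_one ht.ne']
    congr 1; ring
  have hgpos : ∀ k t, ε k < t → g k t = q * t ^ (q - 1) * χ k t := by
    intro k t ht
    simp only [g]
    rw [max_eq_left ht.le]
  have hgnn : ∀ k t, 0 ≤ g k t := fun k t => by
    have : 0 ≤ (max t (ε k)) ^ (q - 1) :=
      Real.rpow_nonneg ((hε k).le.trans (le_max_right _ _)) _
    have := hχ0 k t
    positivity
  have hgle : ∀ k t, 0 < t → g k t ≤ q * t ^ (q - 1) := by
    intro k t ht
    have h0 : 0 ≤ q * t ^ (q - 1) := by positivity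
    rcases le_or_gt t (ε k) with h | h
    · simpa [g, hχsmall k t h] using h0
    · rw [hgpos k t h]
      exact mul_le_of_le_one_right h0 (hχ1 k t)
  have hglim : ∀ t, 0 < t → Filter.Tendsto (fun k => g k t) Filter.atTop
      (nhds (q * t ^ (q - 1))) := by
    intro t ht
    refine tendsto_const_nhds.congr' ?_
    obtain ⟨k₁, hk₁⟩ := exists_nat_ge (2 / t)
    obtain ⟨k₂, hk₂⟩ := exists_nat_ge t
    filter_upwards [Filter.eventually_ge_atTop k₁, Filter.eventually_ge_atTop k₂] with k h1 h2
    have h1' : (k₁ : ℝ) ≤ k := by exact_mod_cast h1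
    have h2' : (k₂ : ℝ) ≤ k := by exact_mod_cast h2
    have h3 : 2 ≤ (k : ℝ) * t := (div_le_iff₀ ht).1 (hk₁.trans h1')
    have hχ : χ k t = 1 := by
      simp only [χ]
      rw [max_eq_right (by nlinarith), max_eq_right (by linarith), min_eq_left (by nlinarith),
        min_eq_left (by linarith), one_mul]
    have hεt : ε k < t := by
      have : 1 < ((k : ℝ) + 1) * t := by nlinarith
      exact (inv_lt_iff_one_lt_mul₀ (by positivity)).2 (by linarith)
    rw [hgpos k t hεt, hχ, mul_one]
  have hg0 : ∀ k, g k 0 = 0 := fun k => by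
    simp [g, hχsmall k 0 (hε k).le]
  let F : ℕ → ℝ → ℝ := fun k t => ∫ s in (0 : ℝ)..t, g k s
  have hint : ∀ t : ℝ, IntervalIntegrable (fun s => q * s ^ (q - 1)) volume 0 t := fun t =>
    (intervalIntegral.intervalIntegrable_rpow' (by linarith)).const_mul q
  have hval : ∀ t : ℝ, ∫ s in (0 : ℝ)..t, q * s ^ (q - 1) = t ^ q := by
    intro t
    rw [intervalIntegral.integral_const_mul, integral_rpow (Or.inl (by linarith)),
      sub_add_cancel, Real.zero_rpow hq.ne', sub_zero, mul_div_cancel₀ _ hq.ne']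
  refine ⟨F, g, fun k t => ((hgc k).integral_hasStrictDerivAt 0 t).hasDerivAt, hgc, fun k => ?_,
    fun k t ht => ?_, fun k t ht => ?_, fun t ht => ?_, fun t ht => ?_⟩
  · have hcs : HasCompactSupport (g k) := by
      refine HasCompactSupport.intro (isCompact_Icc (a := ε k) (b := (k : ℝ) + 1)) fun s hs => ?_
      rw [Set.mem_Icc, not_and_or, not_le, not_le] at hs
      rcases hs with h | h
      · simp [g, hχsmall k s h.le]
      · simp [g, hχlarge k s h.le]
    exact hcs.exists_bound_of_continuous (hgc k)
  · rw [abs_of_nonneg (hgnn k t)]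
    rcases ht.eq_or_lt with rfl | ht
    · simp [hg0]
    · rw [hpow t ht]; exact hgle k t ht
  · rw [abs_of_nonneg (intervalIntegral.integral_nonneg ht fun s _ => hgnn k s), ← hval t]
    refine intervalIntegral.integral_mono_on_of_le_Ioo ht ((hgc k).intervalIntegrable _ _)
      (hint t) fun s hs => hgle k s hs.1
  · rcases ht.eq_or_lt with rfl | ht
    · simp [hg0]
    · rw [hpow t ht]; exact hglim t ht
  · rw [← hval t]
    refine intervalIntegral.tendsto_integral_filter_of_dominated_convergence
      (fun s => q * s ^ (q - 1)) (Filter.Eventually.of_forall fun k =>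
        (hgc k).aestronglyMeasurable) (Filter.Eventually.of_forall fun k => ae_of_all _
        fun s hs => ?_) (hint t) (ae_of_all _ fun s hs => ?_)
    · rw [Set.uIoc_of_le ht] at hs
      rw [Real.norm_of_nonneg (hgnn k s)]
      exact hgle k s hs.1
    · rw [Set.uIoc_of_le ht] at hs
      exact hglim s hs.1

/-- The kernel `(‖z‖² + ε²) ^ (-β / 2)`, a smooth approximation from below of `‖z‖ ^ (-β)`. -/
noncomputable def regKernel {N : ℕ} (β ε : ℝ) (z : RN N) : ℝ :=
  (‖z‖ ^ 2 + ε ^ 2) ^ (-β / 2)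

/-- The radial factor in the gradient `-β (‖z‖² + ε²) ^ (-β / 2 - 1) z` of `regKernel β ε`. -/
noncomputable def regKernelSlope {N : ℕ} (β ε : ℝ) (z : RN N) : ℝ :=
  (‖z‖ ^ 2 + ε ^ 2) ^ (-β / 2 - 1)

section regKernel

variable {N : ℕ} {β ε : ℝ}

theorem regKernel_nonneg (z : RN N) : 0 ≤ regKernel β ε z := by
  unfold regKernel; positivity

theorem regKernelSlope_nonneg (z : RN N) : 0 ≤ regKernelSlope β ε z := by
  unfold regKernelSlope; positivity

theorem contDiff_regKernel (hε : ε ≠ 0) : ContDiff ℝ ∞ (regKernel (N := N) β ε) :=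
  ((contDiff_norm_sq ℝ).add contDiff_const).rpow_const_of_ne fun z =>
    (add_pos_of_nonneg_of_pos (sq_nonneg _) (by positivity : 0 < ε ^ 2)).ne'

theorem continuous_regKernelSlope (hε : ε ≠ 0) : Continuous (regKernelSlope (N := N) β ε) := by
  unfold regKernelSlope
  exact ((continuous_norm.pow 2).add continuous_const).rpow_const fun z =>
    Or.inl (add_pos_of_nonneg_of_pos (sq_nonneg _) (by positivity : 0 < ε ^ 2)).ne'

theorem hasFDerivAt_regKernel (hε : ε ≠ 0) (z : RN N) :
    HasFDerivAt (regKernel β ε) ((-β * regKernelSlope β ε z) • innerSL ℝ z) z := by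
  have h1 : HasFDerivAt (fun z : RN N => ‖z‖ ^ 2 + ε ^ 2) (2 • innerSL ℝ z) z :=
    (hasStrictFDerivAt_norm_sq z).hasFDerivAt.add_const _
  have h2 : HasFDerivAt (regKernel β ε)
      ((-β / 2 * regKernelSlope β ε z) • (2 : ℕ) • innerSL ℝ z) z :=
    h1.rpow_const (p := -β / 2)
      (Or.inl (add_pos_of_nonneg_of_pos (sq_nonneg _) (by positivity : 0 < ε ^ 2)).ne')
  have e : (-β / 2 * regKernelSlope β ε z) • (2 : ℕ) • innerSL ℝ z =
      (-β * regKernelSlope β ε z) • innerSL ℝ z := by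
    rw [← Nat.cast_smul_eq_nsmul ℝ, smul_smul]
    congr 1; push_cast; ring
  rwa [e] at h2

theorem norm_rpow_eq_sq_rpow (z : RN N) : ‖z‖ ^ (-β) = (‖z‖ ^ 2) ^ (-β / 2) := by
  rw [← Real.rpow_natCast, ← Real.rpow_mul (norm_nonneg _)]
  congr 1; push_cast; ring

theorem regKernel_le (hβ : 0 < β) {z : RN N} (hz : z ≠ 0) : regKernel β ε z ≤ ‖z‖ ^ (-β) := by
  rw [norm_rpow_eq_sq_rpow]
  have : 0 < ‖z‖ := norm_pos_iff.2 hz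
  exact Real.rpow_le_rpow_of_nonpos (by positivity) (by nlinarith [sq_nonneg ε]) (by linarith)

theorem regKernelSlope_mul {z : RN N} (h : 0 < ‖z‖ ^ 2 + ε ^ 2) :
    regKernelSlope β ε z * (‖z‖ ^ 2 + ε ^ 2) = regKernel β ε z := by
  unfold regKernelSlope regKernel
  rw [← Real.rpow_add_one h.ne', sub_add_cancel]

end regKernel

/-! ### Integration by parts against a regularised kernel -/

/-- The divergence of a vector field. -/
noncomputable def fieldDiv {N : ℕ} (X : RN N → RN N) (x : RN N) : ℝ :=
  ∑ j, fderiv ℝ (fun x => X x j) x (EuclideanSpace.single j 1)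

section field

variable {N : ℕ} {X : RN N → RN N}

theorem continuous_fieldDiv (hX : ContDiff ℝ ∞ X) : Continuous (fieldDiv X) :=
  continuous_finsetSum _ fun j _ =>
    ((hX.euclideanSpace_apply j).continuous_fderiv (by simp)).clm_apply continuous_const

theorem abs_fieldDiv_le (hX : ContDiff ℝ ∞ X) {x : RN N} {C : ℝ} (hC : ‖fderiv ℝ X x‖ ≤ C) :
    |fieldDiv X x| ≤ N * C := by
  unfold fieldDiv
  refine (Finset.abs_sum_le_sum_abs _ _).trans ?_
  have : ∀ j ∈ (Finset.univ : Finset (Fin N)),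
      |fderiv ℝ (fun x => X x j) x (EuclideanSpace.single j 1)| ≤ C := by
    intro j _
    rw [fderiv_euclideanSpace_apply (hX.differentiable (by simp) x) j, ← Real.norm_eq_abs]
    refine (PiLp.norm_apply_le _ j).trans ((ContinuousLinearMap.le_opNorm _ _).trans ?_)
    simpa using hC
  simpa using Finset.sum_le_sum this

theorem real_inner_eq_sum (a b : RN N) : inner ℝ a b = ∑ j, a j * b j := by
  simp [PiLp.inner_apply, mul_comm]

theorem ae_prod_fst_ne_snd [NeZero N] :
    ∀ᵐ z : RN N × RN N ∂(volume.prod volume), z.1 - z.2 ≠ 0 := by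
  have : Nonempty (Fin N) := ⟨0⟩
  have : Nontrivial (RN N) := inferInstance
  rw [Measure.ae_prod_iff_ae_ae]
  · refine ae_of_all _ fun x => ?_
    have : ∀ᵐ y : RN N, y ≠ x := by simp [ae_iff]
    filter_upwards [this] with y hy h
    exact hy (sub_eq_zero.1 h).symm
  · exact (isOpen_ne_fun (continuous_fst.sub continuous_snd) continuous_const).measurableSet

end field

/-- Integration by parts for a power of `u` against a regularised kernel centred at `y`, with the
power replaced by a `C¹` function with bounded derivative. -/
theorem IsWeakPartial.integral_comp_mul_regKernel {N : ℕ} {u : RN N → ℝ} {G : Fin N → RN N → ℝ}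
    (hG : ∀ i, IsWeakPartial i u (G i)) {F g : ℝ → ℝ} (hF : ∀ t, HasDerivAt F (g t) t)
    (hg : Continuous g) {M : ℝ} (hM : ∀ t, |g t| ≤ M) {X : RN N → RN N} (hX : ContDiff ℝ ∞ X)
    (hXc : HasCompactSupport X) {β ε : ℝ} (hε : ε ≠ 0) (y : RN N) :
    ∫ x, F (u x) * (regKernel β ε (x - y) * fieldDiv X x
      - β * regKernelSlope β ε (x - y) * inner ℝ (x - y) (X x)) =
    -∫ x, regKernel β ε (x - y) * (g (u x) * ∑ j, G j x * X x j) := by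
  have hR : ContDiff ℝ ∞ fun x : RN N => regKernel β ε (x - y) :=
    (contDiff_regKernel hε).comp (contDiff_id.sub contDiff_const)
  have hΨ : ∀ j, ContDiff ℝ ∞ fun x => regKernel β ε (x - y) * X x j := fun j =>
    hR.mul (hX.euclideanSpace_apply j)
  have hΨc : ∀ j, HasCompactSupport fun x => regKernel β ε (x - y) * X x j := fun j =>
    (hXc.euclideanSpace_apply j).mul_left
  have hd : ∀ j x, fderiv ℝ (fun x => regKernel β ε (x - y) * X x j) x
      (EuclideanSpace.single j 1) = regKernel β ε (x - y) *
        fderiv ℝ (fun x => X x j) x (EuclideanSpace.single j 1) -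
        β * regKernelSlope β ε (x - y) * ((x - y) j * X x j) := by
    intro j x
    have h1 : HasFDerivAt (fun x : RN N => regKernel β ε (x - y))
        ((-β * regKernelSlope β ε (x - y)) • innerSL ℝ (x - y)) x := by
      have := (hasFDerivAt_regKernel (β := β) hε (x - y)).comp x
        ((hasFDerivAt_id x).sub_const y)
      rw [ContinuousLinearMap.comp_id] at this
      exact this
    have h2 := ((hX.euclideanSpace_apply j).differentiable (by simp) x).hasFDerivAt
    rw [(h1.fun_mul h2).fderiv]
    simp [real_inner_eq_sum]
    ring
  have hj := fun j => ((hG j).comp hF hg hM).2.2 _ (hΨ j) (hΨc j)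
  have hFi : ∀ j, Integrable fun x => F (u x) *
      fderiv ℝ (fun x => regKernel β ε (x - y) * X x j) x (EuclideanSpace.single j 1) := fun j =>
    integrable_mul_fderiv_of_locallyIntegrable ((hG j).comp hF hg hM).1 (hΨ j) (hΨc j) _
  have hgi : ∀ j, Integrable fun x => g (u x) * G j x * (regKernel β ε (x - y) * X x j) :=
    fun j => ((hG j).comp hF hg hM).2.1.integrable_mul_right (hΨ j).continuous (hΨc j)
  calc _ = ∫ x, ∑ j, F (u x) * fderiv ℝ (fun x => regKernel β ε (x - y) * X x j) x
        (EuclideanSpace.single j 1) := by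
        congr 1; ext x
        rw [← Finset.mul_sum]
        simp only [hd, Finset.sum_sub_distrib, ← Finset.mul_sum, real_inner_eq_sum, fieldDiv]
    _ = ∑ j, -∫ x, g (u x) * G j x * (regKernel β ε (x - y) * X x j) := by
        rw [integral_finsetSum _ fun j _ => hFi j]
        exact Finset.sum_congr rfl fun j _ => hj j
    _ = _ := by
        rw [Finset.sum_neg_distrib, ← integral_finsetSum _ fun j _ => hgi j]
        congr 2; ext x
        rw [Finset.mul_sum, Finset.mul_sum]
        refine Finset.sum_congr rfl fun j _ => by ring

theorem abs_regKernel_bracket_le {N : ℕ} {X : RN N → RN N} (hX : ContDiff ℝ ∞ X) {C₁ C₂ : ℝ}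
    (hC₁ : ∀ x, ‖fderiv ℝ X x‖ ≤ C₁) (hC₂ : ∀ x, ‖X x‖ ≤ C₂) {β ε : ℝ} (hβ : 0 < β)
    (hε : 0 < ε) {z : RN N × RN N} (hz : z.1 - z.2 ≠ 0) :
    |regKernel β ε (z.1 - z.2) * fieldDiv X z.1
      - β * regKernelSlope β ε (z.1 - z.2) * inner ℝ (z.1 - z.2) (X z.1)| ≤
      (N * C₁ + β * (C₂ / ε)) * ‖z.1 - z.2‖ ^ (-β) := by
  have hC₂0 : 0 ≤ C₂ := (norm_nonneg _).trans (hC₂ 0)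
  have hle := regKernel_le (ε := ε) hβ hz
  have hR0 := regKernel_nonneg (β := β) (ε := ε) (z.1 - z.2)
  have hS0 := regKernelSlope_nonneg (β := β) (ε := ε) (z.1 - z.2)
  have hmul := regKernelSlope_mul (β := β) (ε := ε) (z := z.1 - z.2) (by positivity)
  have hin : |inner ℝ (z.1 - z.2) (X z.1)| ≤ ‖z.1 - z.2‖ * C₂ :=
    (abs_real_inner_le_norm _ _).trans (by gcongr; exact hC₂ _)
  have hSn : regKernelSlope β ε (z.1 - z.2) * ‖z.1 - z.2‖ ≤ regKernel β ε (z.1 - z.2) / ε := by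
    rw [le_div_iff₀ hε, ← hmul, mul_assoc]
    gcongr
    nlinarith [sq_nonneg (‖z.1 - z.2‖ - ε), norm_nonneg (z.1 - z.2)]
  have hdiv := abs_fieldDiv_le hX (hC₁ z.1)
  calc _ ≤ regKernel β ε (z.1 - z.2) * |fieldDiv X z.1| +
        β * regKernelSlope β ε (z.1 - z.2) * |inner ℝ (z.1 - z.2) (X z.1)| := by
        refine (abs_sub _ _).trans (le_of_eq ?_)
        rw [abs_mul, abs_of_nonneg hR0, abs_mul, abs_mul, abs_of_pos hβ, abs_of_nonneg hS0]
    _ ≤ regKernel β ε (z.1 - z.2) * (N * C₁) +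
        β * regKernelSlope β ε (z.1 - z.2) * (‖z.1 - z.2‖ * C₂) := by gcongr
    _ = regKernel β ε (z.1 - z.2) * (N * C₁) +
        β * C₂ * (regKernelSlope β ε (z.1 - z.2) * ‖z.1 - z.2‖) := by ring
    _ ≤ regKernel β ε (z.1 - z.2) * (N * C₁) +
        β * C₂ * (regKernel β ε (z.1 - z.2) / ε) := by gcongr
    _ = (N * C₁ + β * (C₂ / ε)) * regKernel β ε (z.1 - z.2) := by ring
    _ ≤ _ := by
      have : 0 ≤ N * C₁ := (abs_nonneg _).trans hdiv
      gcongr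

theorem continuous_regKernel_bracket {N : ℕ} {X : RN N → RN N} (hX : ContDiff ℝ ∞ X) {β ε : ℝ}
    (hε : 0 < ε) :
    Continuous fun z : RN N × RN N => regKernel β ε (z.1 - z.2) * fieldDiv X z.1
      - β * regKernelSlope β ε (z.1 - z.2) * inner ℝ (z.1 - z.2) (X z.1) := by
  have h1 := (contDiff_regKernel (N := N) (β := β) hε.ne').continuous
  have h2 := continuous_regKernelSlope (N := N) (β := β) hε.ne'
  have h3 := continuous_fieldDiv hX
  have h4 := hX.continuous
  fun_prop

theorem integrable_regKernel_bracket {N : ℕ} [NeZero N] {w : RN N × RN N → ℝ} {β ε : ℝ}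
    (hβ : 0 < β) (hε : 0 < ε) (hw : AEStronglyMeasurable w (volume.prod volume))
    (hI : Integrable (fun z : RN N × RN N => ‖z.1 - z.2‖ ^ (-β) * w z) (volume.prod volume))
    {X : RN N → RN N} (hX : ContDiff ℝ ∞ X) (hXc : HasCompactSupport X) :
    Integrable (fun z : RN N × RN N => w z * (regKernel β ε (z.1 - z.2) * fieldDiv X z.1
      - β * regKernelSlope β ε (z.1 - z.2) * inner ℝ (z.1 - z.2) (X z.1)))
      (volume.prod volume) := by
  obtain ⟨C₁, hC₁⟩ := (hXc.fderiv ℝ).exists_bound_of_continuous (hX.continuous_fderiv (by simp))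
  obtain ⟨C₂, hC₂⟩ := hXc.exists_bound_of_continuous hX.continuous
  refine (hI.norm.const_mul (N * C₁ + β * (C₂ / ε))).mono'
    (hw.mul (continuous_regKernel_bracket hX hε).aestronglyMeasurable) ?_
  filter_upwards [ae_prod_fst_ne_snd (N := N)] with z hz
  rw [norm_mul, norm_mul, Real.norm_of_nonneg (Real.rpow_nonneg (norm_nonneg _) _)]
  calc _ ≤ ‖w z‖ * ((N * C₁ + β * (C₂ / ε)) * ‖z.1 - z.2‖ ^ (-β)) := by
        gcongr
        exact abs_regKernel_bracket_le hX hC₁ hC₂ hβ hε hz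
    _ = _ := by ring

/-- Integration by parts of `u ^ q` in the double integral with a regularised kernel: the identity
for fixed `y` is integrated in `y`, and the approximations of `u ^ q` are removed by dominated
convergence, with the two given integrands as majorants. -/
theorem integral_prod_regKernel_field {N : ℕ} [NeZero N] {u : RN N → ℝ} {G : Fin N → RN N → ℝ}
    (hG : ∀ i, IsWeakPartial i u (G i)) (hum : Measurable u) (hu0 : ∀ x, 0 ≤ u x)
    {X : RN N → RN N} (hX : ContDiff ℝ ∞ X) (hXc : HasCompactSupport X) {β ε p q : ℝ}
    (hβ : 0 < β) (hε : 0 < ε) (hq : 0 < q)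
    (hI1 : Integrable (fun z : RN N × RN N => ‖z.1 - z.2‖ ^ (-β) * (u z.2 ^ p * u z.1 ^ q))
      (volume.prod volume))
    (hI2 : Integrable (fun z : RN N × RN N => ‖z.1 - z.2‖ ^ (-β) * (u z.2 ^ p *
      (u z.1 ^ (q - 2) * u z.1 * ∑ j, G j z.1 * X z.1 j))) (volume.prod volume)) :
    ∫ z : RN N × RN N, regKernel β ε (z.1 - z.2) * (u z.2 ^ p *
      (q * (u z.1 ^ (q - 2) * u z.1) * ∑ j, G j z.1 * X z.1 j)) ∂(volume.prod volume) =
    -∫ z : RN N × RN N, u z.2 ^ p * u z.1 ^ q * (regKernel β ε (z.1 - z.2) * fieldDiv X z.1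
      - β * regKernelSlope β ε (z.1 - z.2) * inner ℝ (z.1 - z.2) (X z.1))
      ∂(volume.prod volume) := by
  obtain ⟨F, g, hF, hgc, hgM, hgle, hFle, hglim, hFlim⟩ := exists_approx_rpow hq
  have hFc : ∀ k, Continuous (F k) := fun k =>
    continuous_iff_continuousAt.2 fun t => (hF k t).continuousAt
  set D : RN N × RN N → ℝ := fun z => regKernel β ε (z.1 - z.2) * fieldDiv X z.1
      - β * regKernelSlope β ε (z.1 - z.2) * inner ℝ (z.1 - z.2) (X z.1) with hD
  have hDc : Continuous D := continuous_regKernel_bracket hX hε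
  have hRc : Continuous fun z : RN N × RN N => regKernel β ε (z.1 - z.2) :=
    (contDiff_regKernel hε.ne').continuous.comp (continuous_fst.sub continuous_snd)
  obtain ⟨C₁, hC₁⟩ := (hXc.fderiv ℝ).exists_bound_of_continuous (hX.continuous_fderiv (by simp))
  obtain ⟨C₂, hC₂⟩ := hXc.exists_bound_of_continuous hX.continuous
  have hDle : ∀ z, z.1 - z.2 ≠ 0 → |D z| ≤ (N * C₁ + β * (C₂ / ε)) * ‖z.1 - z.2‖ ^ (-β) :=
    fun z hz => abs_regKernel_bracket_le hX hC₁ hC₂ hβ hε hz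
  have hne := ae_prod_fst_ne_snd (N := N)
  have hu1 : Measurable fun z : RN N × RN N => u z.1 := hum.comp measurable_fst
  have hu2 : Measurable fun z : RN N × RN N => u z.2 := hum.comp measurable_snd
  have hGX : AEStronglyMeasurable (fun z : RN N × RN N => ∑ j, G j z.1 * X z.1 j)
      (volume.prod volume) := by
    have : AEStronglyMeasurable (fun x => ∑ j, G j x * X x j) volume :=
      Finset.aestronglyMeasurable_fun_sum _ fun j _ => (hG j).2.1.aestronglyMeasurable.mul
        (hX.euclideanSpace_apply j).continuous.aestronglyMeasurable
    exact this.comp_fst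
  have hΦm : ∀ k, AEStronglyMeasurable (fun z : RN N × RN N => u z.2 ^ p * F k (u z.1) * D z)
      (volume.prod volume) := fun k =>
    (((hu2.pow_const p).mul ((hFc k).measurable.comp hu1)).mul
      hDc.measurable).aestronglyMeasurable
  have hΓm : ∀ k, AEStronglyMeasurable (fun z : RN N × RN N => regKernel β ε (z.1 - z.2) *
      (u z.2 ^ p * (g k (u z.1) * ∑ j, G j z.1 * X z.1 j))) (volume.prod volume) := fun k =>
    hRc.aestronglyMeasurable.mul ((hu2.pow_const p).aestronglyMeasurable.mul
      (((hgc k).measurable.comp hu1).aestronglyMeasurable.mul hGX))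
  have hΦle : ∀ k, ∀ᵐ z : RN N × RN N ∂(volume.prod volume),
      ‖u z.2 ^ p * F k (u z.1) * D z‖ ≤ (N * C₁ + β * (C₂ / ε)) *
        (‖z.1 - z.2‖ ^ (-β) * (u z.2 ^ p * u z.1 ^ q)) := by
    intro k
    filter_upwards [hne] with z hz
    have h0 : 0 ≤ u z.2 ^ p := Real.rpow_nonneg (hu0 _) _
    rw [norm_mul, norm_mul, Real.norm_of_nonneg h0]
    calc _ ≤ u z.2 ^ p * u z.1 ^ q * ((N * C₁ + β * (C₂ / ε)) * ‖z.1 - z.2‖ ^ (-β)) := by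
          gcongr
          · exact mul_nonneg h0 (Real.rpow_nonneg (hu0 _) _)
          · exact hFle k _ (hu0 _)
          · exact hDle z hz
      _ = _ := by ring
  have hΓle : ∀ k, ∀ᵐ z : RN N × RN N ∂(volume.prod volume),
      ‖regKernel β ε (z.1 - z.2) * (u z.2 ^ p * (g k (u z.1) * ∑ j, G j z.1 * X z.1 j))‖ ≤
        q * ‖‖z.1 - z.2‖ ^ (-β) * (u z.2 ^ p *
          (u z.1 ^ (q - 2) * u z.1 * ∑ j, G j z.1 * X z.1 j))‖ := by
    intro k
    filter_upwards [hne] with z hz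
    have h0 : 0 ≤ u z.2 ^ p := Real.rpow_nonneg (hu0 _) _
    have h1 : 0 ≤ ‖z.1 - z.2‖ ^ (-β) := Real.rpow_nonneg (norm_nonneg _) _
    have h2 : 0 ≤ u z.1 ^ (q - 2) * u z.1 := mul_nonneg (Real.rpow_nonneg (hu0 _) _) (hu0 _)
    simp only [norm_mul]
    rw [Real.norm_of_nonneg h0, Real.norm_of_nonneg h1, ← norm_mul (u z.1 ^ (q - 2)),
      Real.norm_of_nonneg h2, Real.norm_of_nonneg (regKernel_nonneg _)]
    calc _ ≤ ‖z.1 - z.2‖ ^ (-β) * (u z.2 ^ p * (q * (u z.1 ^ (q - 2) * u z.1) *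
          ‖∑ j, G j z.1 * X z.1 j‖)) := by
          gcongr
          · exact regKernel_le hβ hz
          · exact hgle k _ (hu0 _)
      _ = _ := by ring
  have hΦi : ∀ k, Integrable (fun z : RN N × RN N => u z.2 ^ p * F k (u z.1) * D z)
      (volume.prod volume) := fun k => (hI1.const_mul _).mono' (hΦm k) (hΦle k)
  have hΓi : ∀ k, Integrable (fun z : RN N × RN N => regKernel β ε (z.1 - z.2) *
      (u z.2 ^ p * (g k (u z.1) * ∑ j, G j z.1 * X z.1 j))) (volume.prod volume) := fun k =>
    (hI2.norm.const_mul q).mono' (hΓm k) (hΓle k)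
  have hk : ∀ k, ∫ z : RN N × RN N, regKernel β ε (z.1 - z.2) *
      (u z.2 ^ p * (g k (u z.1) * ∑ j, G j z.1 * X z.1 j)) ∂(volume.prod volume) =
      -∫ z : RN N × RN N, u z.2 ^ p * F k (u z.1) * D z ∂(volume.prod volume) := by
    intro k
    rw [integral_prod_symm _ (hΓi k), integral_prod_symm _ (hΦi k), ← integral_neg]
    congr 1; ext y
    obtain ⟨M, hM⟩ := hgM k
    have := IsWeakPartial.integral_comp_mul_regKernel hG (hF k) (hgc k) hM hX hXc (β := β)
      hε.ne' y
    simp only [hD, mul_assoc (u y ^ p), mul_left_comm (regKernel β ε _) (u y ^ p),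
      integral_const_mul]
    rw [this]
    ring
  have lim1 : Filter.Tendsto (fun k => ∫ z : RN N × RN N, regKernel β ε (z.1 - z.2) *
      (u z.2 ^ p * (g k (u z.1) * ∑ j, G j z.1 * X z.1 j)) ∂(volume.prod volume)) Filter.atTop
      (nhds (∫ z : RN N × RN N, regKernel β ε (z.1 - z.2) * (u z.2 ^ p *
      (q * (u z.1 ^ (q - 2) * u z.1) * ∑ j, G j z.1 * X z.1 j)) ∂(volume.prod volume))) := by
    refine tendsto_integral_of_dominated_convergence _ hΓm (hI2.norm.const_mul q) hΓle
      (ae_of_all _ fun z => ?_)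
    exact (((hglim _ (hu0 _)).mul_const _).const_mul _).const_mul _
  have lim2 : Filter.Tendsto (fun k => ∫ z : RN N × RN N, u z.2 ^ p * F k (u z.1) * D z
      ∂(volume.prod volume)) Filter.atTop
      (nhds (∫ z : RN N × RN N, u z.2 ^ p * u z.1 ^ q * D z ∂(volume.prod volume))) := by
    refine tendsto_integral_of_dominated_convergence _ hΦm (hI1.const_mul _) hΦle
      (ae_of_all _ fun z => ?_)
    exact ((hFlim _ (hu0 _)).const_mul _).mul_const _
  exact tendsto_nhds_unique lim1 (lim2.neg.congr fun k => (hk k).symm)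

/-! ### The nonlocal term of the Pohozaev identity -/

theorem norm_sub_le_of_norm_fderiv_le {N : ℕ} {X : RN N → RN N} (hX : ContDiff ℝ ∞ X) {C : ℝ}
    (hC : ∀ x, ‖fderiv ℝ X x‖ ≤ C) (x y : RN N) : ‖X x - X y‖ ≤ C * ‖x - y‖ :=
  Convex.norm_image_sub_le_of_norm_fderiv_le
    (fun x _ => hX.differentiable (by simp) x) (fun x _ => hC x) convex_univ trivial trivial

theorem tendsto_regKernel {N : ℕ} (β : ℝ) {z : RN N} (hz : z ≠ 0) :
    Filter.Tendsto (fun n : ℕ => regKernel β (1 / ((n : ℝ) + 1)) z) Filter.atTop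
      (nhds (‖z‖ ^ (-β))) := by
  have h : 0 < ‖z‖ := norm_pos_iff.2 hz
  rw [norm_rpow_eq_sq_rpow]
  have h1 : Filter.Tendsto (fun n : ℕ => ‖z‖ ^ 2 + (1 / ((n : ℝ) + 1)) ^ 2) Filter.atTop
      (nhds (‖z‖ ^ 2)) := by
    simpa using (tendsto_one_div_add_atTop_nhds_zero_nat (𝕜 := ℝ)).pow 2 |>.const_add (‖z‖ ^ 2)
  exact h1.rpow_const (Or.inl (by positivity))

theorem tendsto_regKernelSlope {N : ℕ} (β : ℝ) {z : RN N} (hz : z ≠ 0) :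
    Filter.Tendsto (fun n : ℕ => regKernelSlope β (1 / ((n : ℝ) + 1)) z) Filter.atTop
      (nhds (‖z‖ ^ (-β) / ‖z‖ ^ 2)) := by
  have h : 0 < ‖z‖ := norm_pos_iff.2 hz
  rw [norm_rpow_eq_sq_rpow, ← Real.rpow_sub_one (by positivity)]
  have h1 : Filter.Tendsto (fun n : ℕ => ‖z‖ ^ 2 + (1 / ((n : ℝ) + 1)) ^ 2) Filter.atTop
      (nhds (‖z‖ ^ 2)) := by
    simpa using (tendsto_one_div_add_atTop_nhds_zero_nat (𝕜 := ℝ)).pow 2 |>.const_add (‖z‖ ^ 2)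
  exact h1.rpow_const (Or.inl (by positivity))

/-- The factor `div X(x) + div X(y) - β (x - y) · (X(x) - X(y)) / |x - y|²` that appears when the
kernel `|x - y| ^ (-β)` is differentiated along the field `X` acting on both variables. -/
noncomputable def rieszFieldFactor {N : ℕ} (β : ℝ) (X : RN N → RN N) (z : RN N × RN N) : ℝ :=
  fieldDiv X z.1 + fieldDiv X z.2 -
    β * (inner ℝ (z.1 - z.2) (X z.1 - X z.2) / ‖z.1 - z.2‖ ^ 2)

theorem abs_rieszFieldFactor_le {N : ℕ} {X : RN N → RN N} (hX : ContDiff ℝ ∞ X) {C β : ℝ}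
    (hβ : 0 < β) (hC : ∀ x, ‖fderiv ℝ X x‖ ≤ C) (z : RN N × RN N) :
    |rieszFieldFactor β X z| ≤ 2 * N * C + β * C := by
  have hC0 : 0 ≤ C := (norm_nonneg _).trans (hC 0)
  have h1 := abs_fieldDiv_le hX (hC z.1)
  have h2 := abs_fieldDiv_le hX (hC z.2)
  have h3 : |inner ℝ (z.1 - z.2) (X z.1 - X z.2) / ‖z.1 - z.2‖ ^ 2| ≤ C := by
    rw [abs_div, abs_of_nonneg (sq_nonneg ‖z.1 - z.2‖)]
    refine div_le_of_le_mul₀ (sq_nonneg _) hC0 ?_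
    calc _ ≤ ‖z.1 - z.2‖ * ‖X z.1 - X z.2‖ := abs_real_inner_le_norm _ _
      _ ≤ ‖z.1 - z.2‖ * (C * ‖z.1 - z.2‖) := by
        gcongr; exact norm_sub_le_of_norm_fderiv_le hX hC _ _
      _ = _ := by ring
  calc _ ≤ |fieldDiv X z.1| + |fieldDiv X z.2| +
        |β * (inner ℝ (z.1 - z.2) (X z.1 - X z.2) / ‖z.1 - z.2‖ ^ 2)| :=
        (abs_sub _ _).trans (by gcongr; exact abs_add_le _ _)
    _ ≤ N * C + N * C + β * C := by
        rw [abs_mul, abs_of_pos hβ]; gcongr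
    _ = _ := by ring

/-- The symmetrised integration by parts for the double integral with the Riesz kernel, obtained by
removing the regularisation. Only the symmetrised right-hand side has a majorant independent of
the regularisation, because `(x - y) · (X(x) - X(y))` is of order `|x - y|²`. -/
theorem integral_prod_rieszKernel_field {N : ℕ} [NeZero N] {u : RN N → ℝ} {G : Fin N → RN N → ℝ}
    (hG : ∀ i, IsWeakPartial i u (G i)) (hum : Measurable u) (hu0 : ∀ x, 0 ≤ u x)
    {X : RN N → RN N} (hX : ContDiff ℝ ∞ X) (hXc : HasCompactSupport X) {β p q : ℝ}
    (hβ : 0 < β) (hp : 0 < p) (hq : 0 < q)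
    (hI : Integrable (fun z : RN N × RN N => ‖z.1 - z.2‖ ^ (-β) * (u z.2 ^ p * u z.1 ^ q))
      (volume.prod volume))
    (hI1 : Integrable (fun z : RN N × RN N => ‖z.1 - z.2‖ ^ (-β) * (u z.2 ^ p *
      (u z.1 ^ (q - 2) * u z.1 * ∑ j, G j z.1 * X z.1 j))) (volume.prod volume))
    (hI2 : Integrable (fun z : RN N × RN N => ‖z.1 - z.2‖ ^ (-β) * (u z.2 ^ q *
      (u z.1 ^ (p - 2) * u z.1 * ∑ j, G j z.1 * X z.1 j))) (volume.prod volume)) :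
    q * (∫ z : RN N × RN N, ‖z.1 - z.2‖ ^ (-β) * (u z.2 ^ p *
      (u z.1 ^ (q - 2) * u z.1 * ∑ j, G j z.1 * X z.1 j)) ∂(volume.prod volume)) +
    p * (∫ z : RN N × RN N, ‖z.1 - z.2‖ ^ (-β) * (u z.2 ^ q *
      (u z.1 ^ (p - 2) * u z.1 * ∑ j, G j z.1 * X z.1 j)) ∂(volume.prod volume)) =
    -∫ z : RN N × RN N, ‖z.1 - z.2‖ ^ (-β) * (u z.2 ^ p * u z.1 ^ q) * rieszFieldFactor β X z
      ∂(volume.prod volume) := by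
  have hne := ae_prod_fst_ne_snd (N := N)
  have hI' : Integrable (fun z : RN N × RN N => ‖z.1 - z.2‖ ^ (-β) * (u z.2 ^ q * u z.1 ^ p))
      (volume.prod volume) := by
    refine hI.swap.congr (ae_of_all _ fun z => ?_)
    simp only [Function.comp, Prod.fst_swap, Prod.snd_swap]
    rw [norm_sub_rev, mul_comm (u z.1 ^ p)]
  have hwm : AEStronglyMeasurable (fun z : RN N × RN N => u z.2 ^ p * u z.1 ^ q)
      (volume.prod volume) :=
    (((hum.comp measurable_snd).pow_const p).mul
      ((hum.comp measurable_fst).pow_const q)).aestronglyMeasurable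
  have hwm' : AEStronglyMeasurable (fun z : RN N × RN N => u z.2 ^ q * u z.1 ^ p)
      (volume.prod volume) :=
    (((hum.comp measurable_snd).pow_const q).mul
      ((hum.comp measurable_fst).pow_const p)).aestronglyMeasurable
  have hGX : AEStronglyMeasurable (fun z : RN N × RN N => ∑ j, G j z.1 * X z.1 j)
      (volume.prod volume) := by
    have : AEStronglyMeasurable (fun x => ∑ j, G j x * X x j) volume :=
      Finset.aestronglyMeasurable_fun_sum _ fun j _ => (hG j).2.1.aestronglyMeasurable.mul
        (hX.euclideanSpace_apply j).continuous.aestronglyMeasurable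
    exact this.comp_fst
  obtain ⟨C, hC⟩ := (hXc.fderiv ℝ).exists_bound_of_continuous (hX.continuous_fderiv (by simp))
  have hC0 : 0 ≤ C := (norm_nonneg _).trans (hC 0)
  let ε : ℕ → ℝ := fun n => 1 / ((n : ℝ) + 1)
  have hε : ∀ n, 0 < ε n := fun n => by positivity
  -- the regularised identity, symmetrised by exchanging the two variables in the second integral
  let B : ℕ → RN N × RN N → ℝ := fun n z =>
    regKernel β (ε n) (z.1 - z.2) * (fieldDiv X z.1 + fieldDiv X z.2) -
      β * regKernelSlope β (ε n) (z.1 - z.2) * inner ℝ (z.1 - z.2) (X z.1 - X z.2)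
  have hreg : ∀ n, (∫ z : RN N × RN N, regKernel β (ε n) (z.1 - z.2) * (u z.2 ^ p *
      (q * (u z.1 ^ (q - 2) * u z.1) * ∑ j, G j z.1 * X z.1 j)) ∂(volume.prod volume)) +
      (∫ z : RN N × RN N, regKernel β (ε n) (z.1 - z.2) * (u z.2 ^ q *
      (p * (u z.1 ^ (p - 2) * u z.1) * ∑ j, G j z.1 * X z.1 j)) ∂(volume.prod volume)) =
      -∫ z : RN N × RN N, u z.2 ^ p * u z.1 ^ q * B n z ∂(volume.prod volume) := by
    intro n
    rw [integral_prod_regKernel_field hG hum hu0 hX hXc hβ (hε n) hq hI hI1,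
      integral_prod_regKernel_field hG hum hu0 hX hXc hβ (hε n) hp hI' hI2, ← neg_add, neg_inj,
      ← integral_prod_swap (fun z : RN N × RN N => u z.2 ^ q * u z.1 ^ p *
        (regKernel β (ε n) (z.1 - z.2) * fieldDiv X z.1
        - β * regKernelSlope β (ε n) (z.1 - z.2) * inner ℝ (z.1 - z.2) (X z.1)))]
    have i1 := integrable_regKernel_bracket hβ (hε n) hwm hI hX hXc
    have i2 := (integrable_regKernel_bracket hβ (hε n) hwm' hI' hX hXc).swap
    refine (integral_add i1 i2).symm.trans ?_
    congr 1; ext z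
    have e1 : regKernel β (ε n) (z.2 - z.1) = regKernel β (ε n) (z.1 - z.2) := by
      simp only [regKernel, norm_sub_rev]
    have e2 : regKernelSlope β (ε n) (z.2 - z.1) = regKernelSlope β (ε n) (z.1 - z.2) := by
      simp only [regKernelSlope, norm_sub_rev]
    have e3 : inner ℝ (z.2 - z.1) (X z.2) = -inner ℝ (z.1 - z.2) (X z.2) := by
      rw [← inner_neg_left, neg_sub]
    simp only [Function.comp, Prod.fst_swap, Prod.snd_swap, e1, e2, e3, B, inner_sub_right]
    ring
  have lhs : ∀ s r : ℝ, Integrable (fun z : RN N × RN N => ‖z.1 - z.2‖ ^ (-β) * (u z.2 ^ s *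
      (u z.1 ^ (r - 2) * u z.1 * ∑ j, G j z.1 * X z.1 j))) (volume.prod volume) →
      Filter.Tendsto (fun n => ∫ z : RN N × RN N, regKernel β (ε n) (z.1 - z.2) * (u z.2 ^ s *
      (r * (u z.1 ^ (r - 2) * u z.1) * ∑ j, G j z.1 * X z.1 j)) ∂(volume.prod volume))
      Filter.atTop (nhds (r * ∫ z : RN N × RN N, ‖z.1 - z.2‖ ^ (-β) * (u z.2 ^ s *
      (u z.1 ^ (r - 2) * u z.1 * ∑ j, G j z.1 * X z.1 j)) ∂(volume.prod volume))) := by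
    intro s r hint
    rw [← integral_const_mul]
    have hm : AEStronglyMeasurable (fun z : RN N × RN N => u z.2 ^ s *
      (r * (u z.1 ^ (r - 2) * u z.1) * ∑ j, G j z.1 * X z.1 j)) (volume.prod volume) :=
      ((hum.comp measurable_snd).pow_const s).aestronglyMeasurable.mul
        ((measurable_const.mul (((hum.comp measurable_fst).pow_const _).mul
          (hum.comp measurable_fst))).aestronglyMeasurable.mul hGX)
    refine tendsto_integral_of_dominated_convergence _ (fun n => AEStronglyMeasurable.mul
      ((contDiff_regKernel (hε n).ne').continuous.comp
        (continuous_fst.sub continuous_snd)).aestronglyMeasurable hm) (hint.const_mul r).norm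
      (fun n => ?_) ?_
    · filter_upwards [hne] with z hz
      have e : r * (‖z.1 - z.2‖ ^ (-β) * (u z.2 ^ s * (u z.1 ^ (r - 2) * u z.1 *
          ∑ j, G j z.1 * X z.1 j))) = ‖z.1 - z.2‖ ^ (-β) * (u z.2 ^ s *
          (r * (u z.1 ^ (r - 2) * u z.1) * ∑ j, G j z.1 * X z.1 j)) := by ring
      rw [e, norm_mul, norm_mul (‖z.1 - z.2‖ ^ (-β)), Real.norm_of_nonneg (regKernel_nonneg _),
        Real.norm_of_nonneg (Real.rpow_nonneg (norm_nonneg _) _)]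
      gcongr
      exact regKernel_le hβ hz
    · filter_upwards [hne] with z hz
      have := (tendsto_regKernel β hz).mul_const (u z.2 ^ s *
          (r * (u z.1 ^ (r - 2) * u z.1) * ∑ j, G j z.1 * X z.1 j))
      refine this.trans (le_of_eq ?_)
      congr 1; ring
  have hBc : ∀ n, Continuous (B n) := by
    intro n
    have h1 := (contDiff_regKernel (N := N) (β := β) (hε n).ne').continuous
    have h2 := continuous_regKernelSlope (N := N) (β := β) (hε n).ne'
    have h3 := continuous_fieldDiv hX
    have h4 := hX.continuous
    simp only [B]
    fun_prop
  have rhs : Filter.Tendsto (fun n => ∫ z : RN N × RN N, u z.2 ^ p * u z.1 ^ q * B n z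
      ∂(volume.prod volume)) Filter.atTop (nhds (∫ z : RN N × RN N,
        ‖z.1 - z.2‖ ^ (-β) * (u z.2 ^ p * u z.1 ^ q) * rieszFieldFactor β X z
        ∂(volume.prod volume))) := by
    refine tendsto_integral_of_dominated_convergence _
      (fun n => hwm.mul (hBc n).aestronglyMeasurable) (hI.const_mul (2 * N * C + β * C))
      (fun n => ?_) ?_
    · filter_upwards [hne] with z hz
      have hw0 : 0 ≤ u z.2 ^ p * u z.1 ^ q :=
        mul_nonneg (Real.rpow_nonneg (hu0 _) _) (Real.rpow_nonneg (hu0 _) _)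
      have hR0 := regKernel_nonneg (β := β) (ε := ε n) (z.1 - z.2)
      have hS0 := regKernelSlope_nonneg (β := β) (ε := ε n) (z.1 - z.2)
      have hn := hε n
      have hmul := regKernelSlope_mul (β := β) (ε := ε n) (z := z.1 - z.2) (by positivity)
      have hSR : regKernelSlope β (ε n) (z.1 - z.2) * ‖z.1 - z.2‖ ^ 2 ≤
          regKernel β (ε n) (z.1 - z.2) := by
        rw [← hmul]; gcongr; nlinarith [sq_nonneg (ε n)]
      have h1 := abs_fieldDiv_le hX (hC z.1)
      have h2 := abs_fieldDiv_le hX (hC z.2)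
      have h3 : |inner ℝ (z.1 - z.2) (X z.1 - X z.2)| ≤ C * ‖z.1 - z.2‖ ^ 2 := by
        calc _ ≤ ‖z.1 - z.2‖ * ‖X z.1 - X z.2‖ := abs_real_inner_le_norm _ _
          _ ≤ ‖z.1 - z.2‖ * (C * ‖z.1 - z.2‖) := by
            gcongr; exact norm_sub_le_of_norm_fderiv_le hX hC _ _
          _ = _ := by ring
      have hB : |B n z| ≤ (2 * N * C + β * C) * ‖z.1 - z.2‖ ^ (-β) := by
        calc |B n z| ≤ regKernel β (ε n) (z.1 - z.2) * (|fieldDiv X z.1| + |fieldDiv X z.2|) +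
              β * regKernelSlope β (ε n) (z.1 - z.2) *
                |inner ℝ (z.1 - z.2) (X z.1 - X z.2)| := by
              refine (abs_sub _ _).trans ?_
              rw [abs_mul, abs_of_nonneg hR0, abs_mul, abs_mul, abs_of_pos hβ, abs_of_nonneg hS0]
              gcongr
              exact abs_add_le _ _
          _ ≤ regKernel β (ε n) (z.1 - z.2) * (N * C + N * C) +
              β * regKernelSlope β (ε n) (z.1 - z.2) * (C * ‖z.1 - z.2‖ ^ 2) := by gcongr
          _ = regKernel β (ε n) (z.1 - z.2) * (2 * N * C) +
              β * C * (regKernelSlope β (ε n) (z.1 - z.2) * ‖z.1 - z.2‖ ^ 2) := by ring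
          _ ≤ regKernel β (ε n) (z.1 - z.2) * (2 * N * C) +
              β * C * regKernel β (ε n) (z.1 - z.2) := by gcongr
          _ = (2 * N * C + β * C) * regKernel β (ε n) (z.1 - z.2) := by ring
          _ ≤ _ := by gcongr; exact regKernel_le hβ hz
      rw [norm_mul, Real.norm_of_nonneg hw0]
      calc _ ≤ u z.2 ^ p * u z.1 ^ q * ((2 * N * C + β * C) * ‖z.1 - z.2‖ ^ (-β)) := by
            gcongr; exact hB
        _ = _ := by ring
    · filter_upwards [hne] with z hz
      have := (((tendsto_regKernel β hz).mul_const (fieldDiv X z.1 + fieldDiv X z.2)).sub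
        (((tendsto_regKernelSlope β hz).const_mul β).mul_const
          (inner ℝ (z.1 - z.2) (X z.1 - X z.2)))).const_mul (u z.2 ^ p * u z.1 ^ q)
      refine this.trans (le_of_eq ?_)
      congr 1
      simp only [rieszFieldFactor]
      ring
  exact tendsto_nhds_unique ((lhs p q hI1).add (lhs q p hI2)) (rhs.neg.congr fun n => (hreg n).symm)

/-- The nonlocal part of the Pohozaev identity: the limit of the symmetrised double integrals as
the cut off fields exhaust the field `x ↦ x`. -/
theorem tendsto_integral_prod_rieszFieldFactor {N : ℕ} [NeZero N] {β : ℝ} (hβ : 0 < β)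
    {w : RN N × RN N → ℝ} (hw : Integrable w (volume.prod volume)) :
    Filter.Tendsto (fun n => ∫ z, w z * rieszFieldFactor β (dilatedField N n) z
      ∂(volume.prod volume)) Filter.atTop
      (nhds ((2 * N - β) * ∫ z, w z ∂(volume.prod volume))) := by
  obtain ⟨C, hC⟩ := exists_norm_fderiv_dilatedField_le N
  rw [← integral_const_mul]
  refine tendsto_integral_of_dominated_convergence _ (fun n => hw.aestronglyMeasurable.mul ?_)
    (hw.norm.mul_const (2 * N * C + β * C)) (fun n => ae_of_all _ fun z => ?_) ?_
  · have h3 := (continuous_fieldDiv (contDiff_dilatedField N n)).measurable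
    have h4 := (contDiff_dilatedField N n).continuous.measurable
    have h5 : Continuous fun z : RN N × RN N =>
        inner ℝ (z.1 - z.2) (dilatedField N n z.1 - dilatedField N n z.2) := by
      have := (contDiff_dilatedField N n).continuous
      fun_prop
    have h6 : Continuous fun z : RN N × RN N => ‖z.1 - z.2‖ ^ 2 := by fun_prop
    exact (((h3.comp measurable_fst).add (h3.comp measurable_snd)).sub
      ((h5.measurable.div h6.measurable).const_mul β)).aestronglyMeasurable
  · rw [norm_mul]
    gcongr
    exact abs_rieszFieldFactor_le (contDiff_dilatedField N n) hβ (hC n) z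
  · filter_upwards [ae_prod_fst_ne_snd (N := N)] with z hz
    refine tendsto_const_nhds.congr' ?_
    filter_upwards [fderiv_dilatedField_eventually z.1, fderiv_dilatedField_eventually z.2,
      dilatedField_eventually z.1, dilatedField_eventually z.2] with n h1 h2 h3 h4
    have hdiv : ∀ x, fderiv ℝ (dilatedField N n) x = ContinuousLinearMap.id ℝ (RN N) →
        fieldDiv (dilatedField N n) x = N := by
      intro x hx
      unfold fieldDiv
      simp only [fderiv_euclideanSpace_apply ((contDiff_dilatedField N n).differentiable
        (by simp) x), hx]
      simp
    have hz' : ‖z.1 - z.2‖ ^ 2 ≠ 0 := by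
      have := norm_pos_iff.2 hz
      positivity
    rw [rieszFieldFactor, hdiv _ h1, hdiv _ h2, h3, h4, real_inner_self_eq_norm_sq,
      div_self hz']
    ring

/-! ### The Nehari and Pohozaev identities for the Choquard equation -/

/-- The Riesz potential of `u ^ s` without its normalising constant. -/
noncomputable def powerPotential {N : ℕ} (β s : ℝ) (u : RN N → ℝ) (x : RN N) : ℝ :=
  ∫ y, ‖x - y‖ ^ (-β) * u y ^ s

section powerPotential

variable {N : ℕ} {β s : ℝ} {u : RN N → ℝ}

theorem measurable_norm_rpow_mul (hum : Measurable u) :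
    Measurable fun z : RN N × RN N => ‖z.1 - z.2‖ ^ (-β) * u z.2 ^ s :=
  ((measurable_fst.sub measurable_snd).norm.pow_const _).mul
    ((hum.comp measurable_snd).pow_const s)

theorem aestronglyMeasurable_powerPotential (hum : Measurable u) :
    AEStronglyMeasurable (powerPotential β s u) volume :=
  (measurable_norm_rpow_mul hum).aestronglyMeasurable.integral_prod_right'

theorem powerPotential_nonneg (hu0 : ∀ x, 0 ≤ u x) (x : RN N) : 0 ≤ powerPotential β s u x :=
  integral_nonneg fun y => mul_nonneg (Real.rpow_nonneg (norm_nonneg _) _)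
    (Real.rpow_nonneg (hu0 y) _)

theorem integrable_prod_powerPotential (hum : Measurable u) (hu0 : ∀ x, 0 ≤ u x)
    (hV : ∀ᵐ x, Integrable fun y => ‖x - y‖ ^ (-β) * u y ^ s) {w : RN N → ℝ}
    (hw : AEStronglyMeasurable w volume)
    (hVw : Integrable fun x => powerPotential β s u x * w x) :
    Integrable (fun z : RN N × RN N => ‖z.1 - z.2‖ ^ (-β) * (u z.2 ^ s * w z.1))
      (volume.prod volume) := by
  have hm : AEStronglyMeasurable
      (fun z : RN N × RN N => ‖z.1 - z.2‖ ^ (-β) * (u z.2 ^ s * w z.1))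
      (volume.prod volume) := by
    simp only [← mul_assoc]
    exact (measurable_norm_rpow_mul hum).aestronglyMeasurable.mul hw.comp_fst
  refine (integrable_prod_iff hm).2 ⟨?_, ?_⟩
  · filter_upwards [hV] with x hx
    simpa only [mul_assoc] using hx.mul_const (w x)
  · refine hVw.norm.congr (ae_of_all _ fun x => ?_)
    simp only [← mul_assoc]
    simp only [norm_mul _ (w x), integral_mul_const]
    congr 1
    rw [Real.norm_of_nonneg (powerPotential_nonneg hu0 x)]
    refine integral_congr_ae (ae_of_all _ fun y => ?_)
    exact (Real.norm_of_nonneg (mul_nonneg (Real.rpow_nonneg (norm_nonneg _) _)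
      (Real.rpow_nonneg (hu0 y) _))).symm

theorem integral_prod_powerPotential {w : RN N → ℝ}
    (hI : Integrable (fun z : RN N × RN N => ‖z.1 - z.2‖ ^ (-β) * (u z.2 ^ s * w z.1))
      (volume.prod volume)) :
    ∫ z : RN N × RN N, ‖z.1 - z.2‖ ^ (-β) * (u z.2 ^ s * w z.1) ∂(volume.prod volume) =
      ∫ x, powerPotential β s u x * w x := by
  rw [integral_prod _ hI]
  simp only [← mul_assoc, integral_mul_const]
  rfl

end powerPotential

theorem rpow_sub_two_mul_self_mul_self {q t : ℝ} (hq : 0 < q) (ht : 0 ≤ t) :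
    t ^ (q - 2) * t * t = t ^ q := by
  rcases ht.eq_or_lt with rfl | ht
  · simp [hq.ne']
  · rw [mul_assoc, ← pow_two, ← Real.rpow_natCast, ← Real.rpow_add ht]
    norm_num

theorem L2Loc.of_nonneg_of_le {N : ℕ} {f g : RN N → ℝ} (hf : L2Loc f)
    (hg : AEStronglyMeasurable g volume) {c : ℝ} (h0 : ∀ᵐ x, 0 ≤ g x)
    (h : ∀ᵐ x, g x ≤ c * f x) : L2Loc g := fun K hK => by
  refine MemLp.mono ((hf K hK).const_mul c) hg.restrict (ae_restrict_of_ae ?_)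
  filter_upwards [h0, h] with x h0 h
  rw [Real.norm_of_nonneg h0]
  exact h.trans (le_abs_self _)

/-- The Nehari and Pohozaev identities for a nonnegative solution of the Choquard equation. The
number `E` is the double integral `∫ (I * u ^ p) u ^ q`, with `c` the constant of the kernel. -/
theorem exists_nehari_pohozaev {N : ℕ} [NeZero N] {u f : RN N → ℝ} {G : Fin N → RN N → ℝ}
    {H : Fin N → Fin N → RN N → ℝ} (hG : ∀ i, IsWeakPartial i u (G i))
    (hH : ∀ i j, IsWeakPartial i (G j) (H i j)) (hum : Measurable u) (hu0 : ∀ x, 0 ≤ u x)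
    (hu : MemLp u 2 volume) (hG2 : ∀ i, MemLp (G i) 2 volume) (hHl : ∀ i j, L2Loc (H i j))
    (hf : ∀ᵐ x, f x = -∑ i, H i i x + u x) {β p q c : ℝ} (hβ : 0 < β) (hp : 0 < p) (hq : 0 < q)
    (hc : 0 < c) (hVp : ∀ᵐ x, Integrable fun y => ‖x - y‖ ^ (-β) * u y ^ p)
    (hVq : ∀ᵐ x, Integrable fun y => ‖x - y‖ ^ (-β) * u y ^ q)
    (hfV : ∀ᵐ x, f x = q * (c * powerPotential β p u x) * (u x ^ (q - 2) * u x) +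
      p * (c * powerPotential β q u x) * (u x ^ (p - 2) * u x)) :
    ∃ E : ℝ, 0 ≤ E ∧
      (∑ i, ∫ x, G i x ^ 2) + ∫ x, u x ^ 2 = (p + q) * E ∧
      (N - 2) / 2 * (∑ i, ∫ x, G i x ^ 2) + N / 2 * ∫ x, u x ^ 2 = (2 * N - β) * E := by
  have hfl : L2Loc f := by
    have h1 : L2Loc fun x => -∑ i, H i i x + u x := fun K hK =>
      (memLp_finsetSum (s := Finset.univ) (f := fun i x => H i i x)
        fun i _ => hHl i i K hK).neg.add (hu.restrict K)
    exact h1.congr_ae (hf.mono fun x hx => hx.symm)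
  have hpow0 : ∀ (r : ℝ) x, 0 ≤ u x ^ (r - 2) * u x := fun r x =>
    mul_nonneg (Real.rpow_nonneg (hu0 x) _) (hu0 x)
  have hpowm : ∀ r : ℝ, AEStronglyMeasurable (fun x => u x ^ (r - 2) * u x) volume := fun r =>
    ((hum.pow_const _).mul hum).aestronglyMeasurable
  have hT0 : ∀ (s r : ℝ) x, 0 ≤ powerPotential β s u x * (u x ^ (r - 2) * u x) := fun s r x =>
    mul_nonneg (powerPotential_nonneg hu0 x) (hpow0 r x)
  have hTm : ∀ s r : ℝ, AEStronglyMeasurable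
      (fun x => powerPotential β s u x * (u x ^ (r - 2) * u x)) volume := fun s r =>
    (aestronglyMeasurable_powerPotential hum).mul (hpowm r)
  have hT1le : ∀ᵐ x, powerPotential β p u x * (u x ^ (q - 2) * u x) ≤ (q * c)⁻¹ * f x := by
    filter_upwards [hfV] with x hx
    rw [le_inv_mul_iff₀ (by positivity), hx]
    have := mul_nonneg (mul_nonneg hp.le hc.le) (hT0 q p x)
    nlinarith
  have hT2le : ∀ᵐ x, powerPotential β q u x * (u x ^ (p - 2) * u x) ≤ (p * c)⁻¹ * f x := by
    filter_upwards [hfV] with x hx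
    rw [le_inv_mul_iff₀ (by positivity), hx]
    have := mul_nonneg (mul_nonneg hq.le hc.le) (hT0 p q x)
    nlinarith
  have hT1 : L2Loc fun x => powerPotential β p u x * (u x ^ (q - 2) * u x) :=
    hfl.of_nonneg_of_le (hTm p q) (ae_of_all _ (hT0 p q)) hT1le
  have hT2 : L2Loc fun x => powerPotential β q u x * (u x ^ (p - 2) * u x) :=
    hfl.of_nonneg_of_le (hTm q p) (ae_of_all _ (hT0 q p)) hT2le
  have hfu0 : ∀ᵐ x, 0 ≤ f x * u x := by
    filter_upwards [hT1le] with x hx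
    have h1 := (hT0 p q x).trans hx
    have : 0 ≤ f x := by
      rwa [mul_nonneg_iff_of_pos_left (by positivity)] at h1
    exact mul_nonneg this (hu0 x)
  obtain ⟨hfui, hneh⟩ := integral_mul_self_of_laplacian hG hH hu hG2 hHl hf hfl hfu0
  have hi1 : Integrable fun x => powerPotential β p u x * u x ^ q := by
    refine (hfui.const_mul (q * c)⁻¹).mono' ((aestronglyMeasurable_powerPotential hum).mul
      (hum.pow_const q).aestronglyMeasurable) ?_
    filter_upwards [hT1le] with x hx
    rw [Real.norm_of_nonneg (mul_nonneg (powerPotential_nonneg hu0 x)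
      (Real.rpow_nonneg (hu0 x) _)), ← rpow_sub_two_mul_self_mul_self hq (hu0 x)]
    have := mul_le_mul_of_nonneg_right hx (hu0 x)
    linarith
  have hi2 : Integrable fun x => powerPotential β q u x * u x ^ p := by
    refine (hfui.const_mul (p * c)⁻¹).mono' ((aestronglyMeasurable_powerPotential hum).mul
      (hum.pow_const p).aestronglyMeasurable) ?_
    filter_upwards [hT2le] with x hx
    rw [Real.norm_of_nonneg (mul_nonneg (powerPotential_nonneg hu0 x)
      (Real.rpow_nonneg (hu0 x) _)), ← rpow_sub_two_mul_self_mul_self hp (hu0 x)]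
    have := mul_le_mul_of_nonneg_right hx (hu0 x)
    linarith
  have hI := integrable_prod_powerPotential hum hu0 hVp
    (hum.pow_const q).aestronglyMeasurable hi1
  have hI' := integrable_prod_powerPotential hum hu0 hVq
    (hum.pow_const p).aestronglyMeasurable hi2
  set D := ∫ z : RN N × RN N, ‖z.1 - z.2‖ ^ (-β) * (u z.2 ^ p * u z.1 ^ q) ∂(volume.prod volume)
    with hD
  have hD1 : ∫ x, powerPotential β p u x * u x ^ q = D := (integral_prod_powerPotential hI).symm
  have hD2 : ∫ x, powerPotential β q u x * u x ^ p = D := by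
    rw [← integral_prod_powerPotential hI', hD, ← integral_prod_swap]
    congr 1; ext z
    rw [Prod.fst_swap, Prod.snd_swap, norm_sub_rev, mul_comm (u z.1 ^ q)]
  have hneh' : ∫ x, f x * u x = (p + q) * (c * D) := by
    have : ∫ x, f x * u x = ∫ x, (q * c * (powerPotential β p u x * u x ^ q) +
        p * c * (powerPotential β q u x * u x ^ p)) := by
      refine integral_congr_ae ?_
      filter_upwards [hfV] with x hx
      rw [hx, ← rpow_sub_two_mul_self_mul_self hq (hu0 x),
        ← rpow_sub_two_mul_self_mul_self hp (hu0 x)]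
      ring
    rw [this, integral_add (hi1.const_mul _) (hi2.const_mul _), integral_const_mul,
      integral_const_mul, hD1, hD2]
    ring
  have hloc := tendsto_integral_mul_dilatedField_of_laplacian hG hH hu hG2 hHl hf
  have hGXl : ∀ n T, L2Loc T →
      Integrable fun x => T x * ∑ j, G j x * dilatedField N n x j := by
    intro n T hT
    simp only [Finset.mul_sum, ← mul_assoc]
    exact integrable_finsetSum _ fun j _ => (hT.mul (hG2 j).l2Loc).integrable_mul_right
      ((contDiff_dilatedField N n).euclideanSpace_apply j).continuous
      ((hasCompactSupport_dilatedField N n).euclideanSpace_apply j)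
  have hGXm : ∀ (n : ℕ) (r : ℝ), AEStronglyMeasurable (fun x => u x ^ (r - 2) * u x *
      ∑ j, G j x * dilatedField N n x j) volume := fun n r =>
    (hpowm r).mul (Finset.aestronglyMeasurable_fun_sum _ fun j _ =>
      (hG2 j).1.mul
        ((contDiff_dilatedField N n).euclideanSpace_apply j).continuous.aestronglyMeasurable)
  have hnonloc : ∀ n, ∫ x, f x * ∑ j, G j x * dilatedField N n x j =
      c * -∫ z : RN N × RN N, ‖z.1 - z.2‖ ^ (-β) * (u z.2 ^ p * u z.1 ^ q) *
        rieszFieldFactor β (dilatedField N n) z ∂(volume.prod volume) := by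
    intro n
    have j1 := hGXl n _ hT1
    have j2 := hGXl n _ hT2
    simp only [mul_assoc (powerPotential β _ u _)] at j1 j2
    have k1 := integrable_prod_powerPotential hum hu0 hVp (hGXm n q) j1
    have k2 := integrable_prod_powerPotential hum hu0 hVq (hGXm n p) j2
    have e1 := integral_prod_powerPotential
      (w := fun x => u x ^ (q - 2) * u x * ∑ j, G j x * dilatedField N n x j) k1
    have e2 := integral_prod_powerPotential
      (w := fun x => u x ^ (p - 2) * u x * ∑ j, G j x * dilatedField N n x j) k2
    rw [← integral_prod_rieszKernel_field hG hum hu0 (contDiff_dilatedField N n)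
      (hasCompactSupport_dilatedField N n) hβ hp hq hI k1 k2, e1, e2, mul_add, ← mul_assoc,
      ← mul_assoc, ← integral_const_mul, ← integral_const_mul,
      ← integral_add (j1.const_mul _) (j2.const_mul _)]
    refine integral_congr_ae ?_
    filter_upwards [hfV] with x hx
    rw [hx]
    ring
  have hlim := ((tendsto_integral_prod_rieszFieldFactor hβ hI).neg.const_mul c).congr
    fun n => (hnonloc n).symm
  have hpoh := tendsto_nhds_unique hloc hlim
  refine ⟨c * D, mul_nonneg hc.le (integral_nonneg fun z => ?_), hneh.symm.trans hneh', ?_⟩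
  · exact mul_nonneg (Real.rpow_nonneg (norm_nonneg _) _)
      (mul_nonneg (Real.rpow_nonneg (hu0 _) _) (Real.rpow_nonneg (hu0 _) _))
  · linear_combination -hpoh

theorem fderiv_apply_eq_sum {N : ℕ} (φ : RN N → ℝ) (x v : RN N) :
    fderiv ℝ φ x v = ∑ i, v i * fderiv ℝ φ x (EuclideanSpace.single i 1) := by
  conv_lhs => rw [← (EuclideanSpace.basisFun (Fin N) ℝ).sum_repr v]
  simp

/-- A weak solution satisfies the equation almost everywhere once the gradient has weak
derivatives. -/
theorem ae_eq_neg_laplacian_add {N : ℕ} {u f : RN N → ℝ} {G : RN N → RN N}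
    {H : Fin N → RN N → ℝ} (hG : IsWeakGradient u G)
    (hH : ∀ i, IsWeakPartial i (fun x => G x i) (H i)) (hu : LocallyIntegrable u)
    (hf : LocallyIntegrable f)
    (heq : ∀ φ : RN N → ℝ, ContDiff ℝ ∞ φ → HasCompactSupport φ →
      (∫ x, fderiv ℝ φ x (G x)) + ∫ x, u x * φ x = ∫ x, f x * φ x) :
    ∀ᵐ x, f x = -∑ i, H i x + u x := by
  have hHl : LocallyIntegrable fun x => -∑ i, H i x + u x := by
    have h1 : LocallyIntegrable fun x => ∑ i, H i x := by
      have := locallyIntegrable_finsetSum (μ := volume) (f := H) Finset.univ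
        fun i _ => (hH i).2.1
      simpa using this
    exact h1.neg.add hu
  refine ae_eq_of_integral_contDiff_smul_eq hf hHl fun φ hφ hφc => ?_
  have h1 : ∫ x, fderiv ℝ φ x (G x) = -∑ i, ∫ x, H i x * φ x := by
    simp only [fderiv_apply_eq_sum φ _ (G _)]
    rw [integral_finsetSum _ fun i _ =>
      integrable_mul_fderiv_of_locallyIntegrable (hG i).2.1 hφ hφc _, ← Finset.sum_neg_distrib]
    exact Finset.sum_congr rfl fun i _ => (hH i).2.2 φ hφ hφc
  have hHi : ∀ i, Integrable fun x => H i x * φ x := fun i =>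
    (hH i).2.1.integrable_mul_right hφ.continuous hφc
  have hui : Integrable fun x => u x * φ x := hu.integrable_mul_right hφ.continuous hφc
  have h2 : ∫ x, φ x • (-∑ i, H i x + u x) = (∫ x, u x * φ x) - ∑ i, ∫ x, H i x * φ x := by
    rw [← integral_finsetSum _ fun i _ => hHi i, ← integral_sub hui
      (integrable_finsetSum _ fun i _ => hHi i)]
    congr 1; ext x
    rw [← Finset.sum_mul, smul_eq_mul]; ring
  rw [h2]
  have h3 := heq φ hφ hφc
  simp only [smul_eq_mul, mul_comm (φ _)]
  linarith

theorem MeasureTheory.MemLp.euclideanSpace_apply {N : ℕ} {G : RN N → RN N}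
    {μ : Measure (RN N)} (hG : MemLp G 2 μ) (i : Fin N) : MemLp (fun x => G x i) 2 μ :=
  (EuclideanSpace.proj i : RN N →L[ℝ] ℝ).comp_memLp' hG

/-- The normalising constant of the Riesz potential. -/
noncomputable def rieszConst (N : ℕ) (α : ℝ) : ℝ :=
  Real.Gamma ((N - α) / 2) / (Real.pi ^ ((N : ℝ) / 2) * 2 ^ α * Real.Gamma (α / 2))

theorem rieszConst_pos {N : ℕ} {α : ℝ} (hα : 0 < α) (hαN : α < N) : 0 < rieszConst N α := by
  have h1 := Real.Gamma_pos_of_pos (s := (N - α) / 2) (by linarith)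
  have h2 := Real.Gamma_pos_of_pos (s := α / 2) (by linarith)
  have := Real.pi_pos
  unfold rieszConst
  positivity

theorem rieszKernel_eq {N : ℕ} (α : ℝ) (x : RN N) :
    rieszKernel N α x = rieszConst N α * ‖x‖ ^ (-(N - α)) := by
  rw [rieszKernel, rieszConst, neg_sub]; ring

theorem rieszConv_eq {N : ℕ} {α s : ℝ} {u U : RN N → ℝ} (h : u =ᵐ[volume] U)
    (hU : ∀ x, 0 ≤ U x) (x : RN N) :
    rieszConv α s u x = rieszConst N α * powerPotential (N - α) s U x := by
  rw [rieszConv, convolution_eq_swap, powerPotential, ← integral_const_mul]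
  refine integral_congr_ae ?_
  filter_upwards [h] with y hy
  simp only [ContinuousLinearMap.mul_apply', rieszKernel_eq, hy, abs_of_nonneg (hU y), mul_assoc]

theorem RieszConvExists.ae_integrable {N : ℕ} {α s : ℝ} {u U : RN N → ℝ}
    (hc : 0 < rieszConst N α) (hconv : RieszConvExists α s u) (h : u =ᵐ[volume] U)
    (hU : ∀ x, 0 ≤ U x) :
    ∀ᵐ x, Integrable fun y => ‖x - y‖ ^ (-(N - α)) * U y ^ s := by
  filter_upwards [hconv] with x hx
  rw [convolutionExistsAt_iff_integrable_swap] at hx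
  refine (hx.const_mul (rieszConst N α)⁻¹).congr ?_
  filter_upwards [h] with y hy
  simp only [ContinuousLinearMap.mul_apply', rieszKernel_eq, hy, abs_of_nonneg (hU y)]
  rw [mul_assoc, inv_mul_cancel_left₀ hc.ne']

theorem theorem1p2 (N : ℕ) (hN : 3 ≤ N) (α p q : ℝ) (hα : 0 < α) (hαN : α < N)
    (hp : 0 < p) (hq : 0 < q)
    (hpq : 2 * (N + α) / (N - 2) ≤ p + q ∨ p + q ≤ 2 * (N + α) / N)
    (u : RN N → ℝ) (hu : ∀ᵐ x, 0 ≤ u x)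
    (hsol : IsChoquardSolution α p q u)
    (hLs : MemLp u (ENNReal.ofReal (N * (p + q) / (N + α))) volume)
    (hgrad : GradMemH1Loc u) :
    ∀ᵐ x, u x = 0 := by
  have : NeZero N := ⟨by omega⟩
  obtain ⟨⟨hu2, G₀, hG₀, hG₀2⟩, hconvp, hconvq, hfl, G₁, hG₁, heq⟩ := hsol
  obtain ⟨G, hG, hGH⟩ := hgrad
  choose _ H hH hHl using hGH
  have h0 : ∀ i, (fun x => G₀ x i) =ᵐ[volume] fun x => G x i := fun i =>
    (hG₀ i).ae_unique (hG i)
  have h1 : ∀ᵐ x, G₁ x = G x := by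
    filter_upwards [ae_all_iff.2 fun i => (hG₁ i).ae_unique (hG i)] with x hx
    ext i; exact hx i
  -- a measurable representative of `u` that is nonnegative everywhere
  obtain ⟨v, hvm, huv⟩ := hu2.1.aemeasurable
  set U : RN N → ℝ := fun x => max (v x) 0
  have hU0 : ∀ x, 0 ≤ U x := fun x => le_max_right _ _
  have hUm : Measurable U := hvm.max measurable_const
  have huU : u =ᵐ[volume] U := by
    filter_upwards [hu, huv] with x h0 hx
    simp only [U]
    rw [← hx, max_eq_left h0]
  have hae := ae_eq_neg_laplacian_add (H := fun i x => H i x i) hG (fun i => hH i i)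
    (hG ⟨0, by omega⟩).1 hfl fun φ hφ hφc => by
      rw [← heq φ hφ hφc]
      congr 1
      refine integral_congr_ae ?_
      filter_upwards [h1] with x hx
      rw [hx]
  have hcpos := rieszConst_pos hα hαN
  have hGU : ∀ i, IsWeakPartial i U fun x => G x i := fun i => (hG i).congr_ae huU ae_eq_rfl
  have hU2 : MemLp U 2 volume := hu2.ae_eq huU
  have hG2 : ∀ i, MemLp (fun x => G x i) 2 volume := fun i =>
    (hG₀2.euclideanSpace_apply i).ae_eq (h0 i)
  obtain ⟨E, hE, hneh, hpoh⟩ := exists_nehari_pohozaev (f := choquardRHS α p q u)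
    (G := fun i x => G x i) (H := fun i j x => H j x i) (β := N - α) (c := rieszConst N α)
    hGU (fun i j => hH j i) hUm hU0 hU2 hG2
    (fun i j K hK => (hHl j K hK).euclideanSpace_apply i)
    (by filter_upwards [hae, huU] with x hx hxU; rw [hx, hxU])
    (by linarith) hp hq hcpos (hconvp.ae_integrable hcpos huU hU0)
    (hconvq.ae_integrable hcpos huU hU0)
    (by
      filter_upwards [huU] with x hx
      rw [choquardRHS, rieszConv_eq huU hU0, rieszConv_eq huU hU0, hx, abs_of_nonneg (hU0 x)])
  set A := ∑ i, ∫ x, G x i ^ 2 with hA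
  set B := ∫ x, U x ^ 2
  have hA0 : ∀ i, 0 ≤ ∫ x, G x i ^ 2 := fun i => integral_nonneg fun x => sq_nonneg _
  have hB0 : 0 ≤ B := integral_nonneg fun x => sq_nonneg _
  have hN' : (3 : ℝ) ≤ N := by exact_mod_cast hN
  have hB : B = 0 := by
    rcases hpq with h | h
    · rw [div_le_iff₀ (by linarith)] at h
      nlinarith [mul_le_mul_of_nonneg_right h hE]
    · rw [le_div_iff₀ (by linarith)] at h
      have hA' : A = 0 := by
        refine le_antisymm ?_ (Finset.sum_nonneg fun i _ => hA0 i)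
        nlinarith [mul_le_mul_of_nonneg_right h hE]
      refine integral_sq_eq_zero_of_weakGradient_eq_zero (by omega) hGU hU2 hG2 fun i => ?_
      have hi := (Finset.sum_eq_zero_iff_of_nonneg fun i _ => hA0 i).1 hA' i (Finset.mem_univ i)
      rw [integral_eq_zero_iff_of_nonneg (fun x => sq_nonneg _) (hG2 i).integrable_sq] at hi
      filter_upwards [hi] with x hx
      exact pow_eq_zero_iff two_ne_zero |>.1 hx
  have hU := (integral_eq_zero_iff_of_nonneg (fun x => sq_nonneg _) hU2.integrable_sq).1 hB
  filter_upwards [hU, huU] with x hx hxU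
  rw [hxU]
  exact pow_eq_zero_iff two_ne_zero |>.1 hx
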